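/- Let $M$ be a compact smooth manifold of dimension $m\ge 1$ with (possibly empty) boundary, equipped with a smooth positive density $\mathrm{dvol}_M$ (for example a Riemannian volume), and let $E\to M$ be a smooth Hermitian vector bundle. Put $t=1/\mu$ and consider $[0,\infty)_t\times M\times M$ with its submanifolds $$\mathscr C=\{t=0,\ p=\widetilde p\in\partial M\},\qquad \mathscr D=\{t=0,\ p=\widetilde p\}.$$ Let $\mathscr M^2_b=[[[0,\infty)\times M^2,\mathscr C],\mathscr D]$ be the manifold with corners obtained by blowing up $\mathscr C$ and then the lift of $\mathscr D$, with blow-down map $\beta$. Its boundary hypersurfaces are the front face $\mathrm{ff}$ and the temporal diagonal $\mathrm{td}$, created by the first and second blowup, and the lifts $\mathrm{tf}$ of $\{t=0\}$, $\mathrm{rf}$ of $\{p\in\partial M\}$, $\mathrm{lf}$ of $\{\widetilde p\in\partial M\}$. For $\ell\in\mathbb R$ let $\mathscr A^{\ell,\infty}_{phg}(\mathscr M^2_b)$ be the space of families of Schwartz kernels $R(p,\widetilde p;\mu)\in\mathrm{Hom}(E_{\widetilde p},E_p)$, $\mu\in(0,\infty)$, whose lift $\beta^*R$ is smooth in the interior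 and is a polyhomogeneous conormal function on $\mathscr M^2_b$ with leading order $-m+\ell$ at $\mathrm{ff}$ (all exponents $\gamma$ in the expansion at $\mathrm{ff}$ have $\mathrm{Re}\,\gamma\ge -m+\ell$, without logarithms if $\mathrm{Re}\,\gamma=-m+\ell$), with index set $\mathbb N_0$ (smoothness) at $\mathrm{lf}$ and $\mathrm{rf}$, and vanishing to infinite order at $\mathrm{td}$ and at $\mathrm{tf}$. Proposition. Let $R\in\mathscr A^{\ell,\infty}_{phg}(\mathscr M^2_b)$. Then for every $\mu>0$ the integral operator $$(R(\cdot,\mu)s)(p)=\int_M R(p,\widetilde p;\mu)\,s(\widetilde p)\,\mathrm{dvol}_M(\widetilde p)$$ is a Hilbert–Schmidt operator on $L^2(M,E)$, and its Hilbert–Schmidt norm satisfies $$\|R(\cdot,\mu)\|_{HS}=O\big(\mu^{-\ell+m/2}\big)\quad\text{as }\mu\to\infty .$$ -/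

import Mathlib

open MeasureTheory Filter Asymptotics
open scoped Manifold ContDiff ENNReal

noncomputable section

/-! ## Polyhomogeneous conormal functions on a model corner

The model corner is `{x : ι → ℝ | 0 ≤ x i for i ∈ s}`, with one boundary hypersurface `{x i = 0}`
(defining function `x i`) for every `i ∈ s`. Functions are only evaluated in its interior. -/

/-- Index sets: subsets of `ℂ × ℕ` whose exponents have real parts accumulating only at `+∞`, and
which are closed under lowering the power of the logarithm and under raising the exponent by
natural numbers. -/
structure IndexSet where
  carrier : Set (ℂ × ℕ)
  finite_le : ∀ N : ℝ, {g ∈ carrier | g.1.re ≤ N}.Finite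
  mem_of_mem : ∀ (γ : ℂ) (p : ℕ), (γ, p) ∈ carrier →
    ∀ j p' : ℕ, p' ≤ p → (γ + (j : ℂ), p') ∈ carrier

namespace IndexSet

/-- The finitely many elements `(γ, p)` of an index set with `Re γ ≤ N`. -/
def upTo (E : IndexSet) (N : ℝ) : Finset (ℂ × ℕ) := (E.finite_le N).toFinset

/-- The empty index set: vanishing to infinite order. -/
def empty : IndexSet where
  carrier := ∅
  finite_le := by intro N; simp
  mem_of_mem := by intro γ p h; exact h.elim

/-- The index set `ℕ₀ = {(j, 0)}`: smoothness up to the face. -/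
def nat : IndexSet where
  carrier := {g | ∃ j : ℕ, g = ((j : ℂ), 0)}
  finite_le := by
    intro N
    refine ((Set.finite_le_nat ⌊N⌋₊).image (fun j : ℕ => ((j : ℂ), 0))).subset ?_
    rintro g ⟨⟨j, rfl⟩, h⟩
    refine ⟨j, ?_, rfl⟩
    exact Nat.le_floor (by simpa using h)
  mem_of_mem := by
    rintro γ p ⟨k, hk⟩ j p' hp
    obtain ⟨rfl, rfl⟩ := Prod.mk.inj hk
    exact ⟨k + j, by simp; omega⟩

/-- `E` has leading order `a`: every exponent has real part at least `a`, and there is no logarithm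
at order `a` itself. For `a = ⊤` this says that `E` is empty. -/
def HasLeadingOrder (E : IndexSet) (a : WithTop ℝ) : Prop :=
  ∀ g ∈ E.carrier, a ≤ (g.1.re : WithTop ℝ) ∧ (a = (g.1.re : WithTop ℝ) → g.2 = 0)

end IndexSet

section Phg

variable {ι : Type*} [Fintype ι] [DecidableEq ι] {F : Type*} [NormedAddCommGroup F]
  [NormedSpace ℂ F]

/-- The part of `W` in the interior of the model corner with boundary coordinates `s`. -/
def cornerInterior (s : Finset ι) (W : Set (ι → ℝ)) : Set (ι → ℝ) := {x ∈ W | ∀ i ∈ s, 0 < x i}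

/-- The generators of the b-vector fields (those tangent to all boundary faces):
`x i ∂_i` for boundary coordinates and `∂_i` for the others. -/
def bDeriv (s : Finset ι) (i : ι) (u : (ι → ℝ) → F) : (ι → ℝ) → F :=
  fun x => (if i ∈ s then x i else 1) • fderiv ℝ u x (Pi.single i 1)

/-- Iterated application of the generators of the b-vector fields. -/
def bDerivs (s : Finset ι) (l : List ι) (u : (ι → ℝ) → F) : (ι → ℝ) → F :=
  l.foldr (bDeriv s) u

/-- `u` is smooth in the interior, and `u` together with all its b-derivatives is
`O(∏_{i ∈ s} (x i)^(b i))`, uniformly on `W`. -/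
def ConormalOn (s : Finset ι) (W : Set (ι → ℝ)) (b : ι → ℝ) (u : (ι → ℝ) → F) : Prop :=
  ContDiffOn ℝ ∞ u (cornerInterior s W) ∧
  ∀ l : List ι, ∃ C : ℝ, ∀ x ∈ cornerInterior s W,
    ‖bDerivs s l u x‖ ≤ C * ∏ i ∈ s, (x i) ^ (b i)

/-- Polyhomogeneity with index sets `E` on the part in `W` of the model corner with boundary
coordinates `s`: `u` is conormal and has, at each face `x i = 0`, an expansion
`u ∼ ∑_{(γ, p) ∈ E i} a_{γ,p} (x i)^γ (log x i)^p`, where the coefficients are functions on the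
face which are again polyhomogeneous with the index sets of the remaining faces. The expansion means
that the remainder after the terms with `Re γ ≤ N` is conormal of order `N` at the face. -/
inductive PhgOn (E : ι → IndexSet) (W : Set (ι → ℝ)) : Finset ι → ((ι → ℝ) → F) → Prop
  | mk {s : Finset ι} {u : (ι → ℝ) → F} (b : ι → ℝ) (a : ι → ℂ × ℕ → (ι → ℝ) → F)
      (conormal : ConormalOn s W b u)
      (coeff_indep : ∀ i ∈ s, ∀ g ∈ (E i).carrier, ∀ (x : ι → ℝ) (c : ℝ),
        a i g (Function.update x i c) = a i g x)
      (coeff_phg : ∀ i ∈ s, ∀ g ∈ (E i).carrier, PhgOn E W (s.erase i) (a i g))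
      (remainder : ∀ i ∈ s, ∀ N : ℕ, ConormalOn s W (Function.update b i (N : ℝ))
        (fun x => u x - ∑ g ∈ (E i).upTo N,
          (((x i : ℝ) : ℂ) ^ g.1 * ((Real.log (x i) : ℝ) : ℂ) ^ g.2) • a i g x)) :
      PhgOn E W s u

variable {Φ : Type*}

/-- Let coordinates be given in which `{y i = 0}` is (part of) the boundary hypersurface `f` if
`face i = some f`, and `y i` is an interior coordinate if `face i = none`. `PhgAt face E u y₀` says
that `u` is polyhomogeneous near the point `y₀` of the corner, with index set `E f` at the
hypersurface `f`. Only the faces through `y₀` matter. -/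
def PhgAt (face : ι → Option Φ) (E : Φ → IndexSet) (u : (ι → ℝ) → F) (y₀ : ι → ℝ) : Prop :=
  ∃ δ > 0, PhgOn (fun i => (face i).elim IndexSet.empty E) (Metric.ball y₀ δ)
    (Finset.univ.filter fun i => (face i).isSome ∧ y₀ i = 0) u

end Phg

/-! ## The blowup of `[0, ∞) × M × M`

Coordinates on `[0, ∞) × M × M` are `t = 1/μ`, coordinates `z` of the first and `w` of the second
point, where `z 0 ≥ 0` and `w 0 ≥ 0` define the boundary of `M`. -/

/-- The labels of the `2m + 1` coordinates. -/
abbrev Coord (m : ℕ) : Type := Option (Fin m ⊕ Fin m)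

/-- The coordinate `t = 1/μ`. -/
abbrev Coord.t {m : ℕ} : Coord m := none

/-- The coordinates of the first point. -/
abbrev Coord.z {m : ℕ} (i : Fin m) : Coord m := some (Sum.inl i)

/-- The coordinates of the second point. -/
abbrev Coord.w {m : ℕ} (i : Fin m) : Coord m := some (Sum.inr i)

/-- The boundary hypersurfaces of the blowup: left, right and temporal face, temporal diagonal,
front face. -/
inductive Face
  | lf
  | rf
  | tf
  | td
  | ff

section Blowup

variable {m : ℕ} [NeZero m]

open Coord

/-- The faces of `[0, ∞) × M × M`: tf is `{t = 0}`, rf is `{z 0 = 0}`, lf is `{w 0 = 0}`. -/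
def baseFace : Coord m → Option Face
  | none => some Face.tf
  | some (Sum.inl i) => if i = 0 then some Face.rf else none
  | some (Sum.inr i) => if i = 0 then some Face.lf else none

/-- The projective coordinates for the blowup of `{y i = 0 for all i ∈ I}`, near the directions in
which `ε * y j` is positive and dominates (`j ∈ I`, `ε = ±1`): the coordinate `j` becomes
`ε * y j`, the defining function of the new face, and the other ones in `I` are divided by it. This
is the blow-down map in these coordinates. -/
def projBlowdown (I : Finset (Coord m)) (j : Coord m) (ε : ℝ) (y : Coord m → ℝ) : Coord m → ℝ :=
  fun i => if i = j then ε * y j else if i ∈ I then y j * y i else y i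

/-- `(t, d, w) ↦ (t, z = w + d, w)`. -/
def fromDiff (y : Coord m → ℝ) : Coord m → ℝ
  | none => y t
  | some (Sum.inl i) => y (w i) + y (z i)
  | some (Sum.inr i) => y (w i)

/-- As `fromDiff`, but only for the coordinates along the boundary of `M`:
`(t, x, d', x', w') ↦ (t, (x, w' + d'), (x', w'))`. -/
def fromTangentialDiff (y : Coord m → ℝ) : Coord m → ℝ
  | none => y t
  | some (Sum.inl i) => if i = 0 then y (z 0) else y (w i) + y (z i)
  | some (Sum.inr i) => y (w i)

/-- In the coordinates before `fromTangentialDiff`, these vanish on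
`𝒞 = {t = 0, z 0 = w 0 = 0, z i = w i for i ≠ 0}`. -/
def centreC : Finset (Coord m) := Finset.univ.filter fun i => i = t ∨ i = w 0 ∨ ∃ k, i = z k

/-- In the coordinates before `fromDiff`, these vanish on `𝒟 = {t = 0, z = w}`. -/
def centreD : Finset (Coord m) := Finset.univ.filter fun i => i = t ∨ ∃ k, i = z k

/-- A family of coordinates on the blowup: the blow-down map in these coordinates, the boundary
hypersurfaces defined by them, and the set of those points on the face created by the blowup which
they cover. -/
structure CornerChart (m : ℕ) where
  blowdown : (Coord m → ℝ) → (Coord m → ℝ)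
  face : Coord m → Option Face
  points : Set (Coord m → ℝ)

/-- Projective coordinates for the blowup of `𝒞`; `y j` defines ff, and `t`, `z 0`, `w 0` (when
different from `y j`) define tf, rf, lf. The points are those of ff, except for the ones on the lift
of `𝒟`; the direction of the point `y` is `v`, and the lift of `𝒟` consists of the directions with
`t = 0`, `z 0 = w 0` and vanishing tangential difference. -/
def chartC (j : Coord m) (ε : ℝ) : CornerChart m where
  blowdown := fun y => fromTangentialDiff (projBlowdown centreC j ε y)
  face := fun i => if i = j then some Face.ff else baseFace i
  points := {y | y j = 0 ∧ 0 ≤ y t ∧ 0 ≤ y (z 0) ∧ 0 ≤ y (w 0) ∧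
    ¬ (let v := Function.update y j ε
       v t = 0 ∧ v (z 0) = v (w 0) ∧ ∀ k : Fin m, k ≠ 0 → v (z k) = 0)}

/-- Projective coordinates for the blowup of `𝒟` over the interior of `M`; `y j` defines td. -/
def chartD (j : Coord m) (ε : ℝ) : CornerChart m where
  blowdown := fun y => fromDiff (projBlowdown centreD j ε y)
  face := fun i => if i = j then some Face.td else if i = t then some Face.tf else none
  points := {y | y j = 0 ∧ 0 ≤ y t ∧ 0 < y (w 0)}

/-- Projective coordinates for the blowup of the lift of `𝒟` at the front face. In the projective
coordinates `τ = t / w 0`, `s = z 0 / w 0`, `u = d' / w 0`, `w` for the blowup of `𝒞`, the lift of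
`𝒟` is `{τ = 0, s = 1, u = 0}`; here `s - 1` takes the place of the coordinate `z 0`. Then `y j`
defines td, and `w 0` defines ff. The points are those of td ∩ ff. -/
def chartCD (j : Coord m) (ε : ℝ) : CornerChart m where
  blowdown := fun y =>
    let v := projBlowdown centreD j ε y
    fromTangentialDiff (projBlowdown centreC (w 0) 1 (Function.update v (z 0) (1 + v (z 0))))
  face := fun i => if i = j then some Face.td else if i = w 0 then some Face.ff
    else if i = t then some Face.tf else none
  points := {y | y j = 0 ∧ 0 ≤ y t ∧ y (w 0) = 0}

/-- The projective coordinates covering all points of the blowup over `𝒞 ∪ 𝒟`. Boundary coordinates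
are only positive, the others take both signs. -/
def blowupAtlas (m : ℕ) [NeZero m] : Set (CornerChart m) :=
  {c | ∃ j ∈ (centreC : Finset (Coord m)), ∃ ε : ℝ,
      (ε = 1 ∨ (ε = -1 ∧ baseFace j = none)) ∧ c = chartC j ε} ∪
  {c | ∃ j ∈ (centreD : Finset (Coord m)), ∃ ε : ℝ,
      (ε = 1 ∨ (ε = -1 ∧ j ≠ t)) ∧ (c = chartD j ε ∨ c = chartCD j ε)}

end Blowup

/-! ## Hermitian vector bundles, smooth densities, `L²(M, E)` -/

/-- Typical fibre of a Hermitian vector bundle of rank `r`. -/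
abbrev TypicalFiber (r : ℕ) : Type := EuclideanSpace ℂ (Fin r)

/-- A smooth Hermitian vector bundle structure of rank `r` on a family `E` of complex inner product
spaces over `M`: a cover of `M` by open sets with unitary frames of `E` (the values of a frame
outside of its domain are irrelevant) which are related by smooth transition functions. -/
structure HermitianBundle (m : ℕ) [NeZero m] {M : Type*} [TopologicalSpace M]
    [ChartedSpace (EuclideanHalfSpace m) M] (r : ℕ) (E : M → Type*)
    [∀ p, NormedAddCommGroup (E p)] [∀ p, InnerProductSpace ℂ (E p)] where
  Idx : Type*
  dom : Idx → Set M
  isOpen_dom : ∀ i, IsOpen (dom i)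
  cover : ∀ p, ∃ i, p ∈ dom i
  frame : Idx → ∀ p, E p ≃ₗᵢ[ℂ] TypicalFiber r
  smooth : ∀ i j, ContMDiffOn (𝓡∂ m) 𝓘(ℝ, TypicalFiber r →L[ℂ] TypicalFiber r) ∞
    (fun p => (((frame i p).symm.trans (frame j p)).toContinuousLinearEquiv :
      TypicalFiber r →L[ℂ] TypicalFiber r)) (dom i ∩ dom j)

/-- `ν` is given in every chart by a smooth positive density with respect to Lebesgue measure (for
example the volume measure of a Riemannian metric). -/
def IsSmoothDensity (m : ℕ) [NeZero m] {M : Type*} [TopologicalSpace M]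
    [ChartedSpace (EuclideanHalfSpace m) M] [MeasurableSpace M] (ν : Measure M) : Prop :=
  ∀ e ∈ IsManifold.maximalAtlas (𝓡∂ m) ∞ M, ∃ ρ : EuclideanSpace ℝ (Fin m) → ℝ,
    ContDiffOn ℝ ∞ ρ (e.extend (𝓡∂ m)).target ∧
    (∀ x ∈ (e.extend (𝓡∂ m)).target, 0 < ρ x) ∧
    ∀ B : Set M, MeasurableSet B → B ⊆ e.source →
      ν B = ∫⁻ x in e.extend (𝓡∂ m) '' B, ENNReal.ofReal (ρ x)

namespace HermitianBundle

variable {m : ℕ} [NeZero m] {M : Type*} [TopologicalSpace M]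
  [ChartedSpace (EuclideanHalfSpace m) M] {r : ℕ} {E : M → Type*}
  [∀ p, NormedAddCommGroup (E p)] [∀ p, InnerProductSpace ℂ (E p)]

section L2

variable [CompactSpace M]

theorem exists_finset_cover (A : HermitianBundle m r E) :
    ∃ S : Finset A.Idx, (⋃ i : S, A.dom i) = Set.univ := by
  obtain ⟨S, hS⟩ := isCompact_univ.elim_finite_subcover A.dom A.isOpen_dom
    (fun p _ => Set.mem_iUnion.2 (A.cover p))
  refine ⟨S, Set.eq_univ_of_forall fun p => ?_⟩
  obtain ⟨i, hi, hp⟩ := Set.mem_iUnion₂.1 (hS (Set.mem_univ p))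
  exact Set.mem_iUnion.2 ⟨⟨i, hi⟩, hp⟩

variable [MeasurableSpace M]

/-- Measurability of a section: all its local representations are measurable (up to null sets). -/
def MeasurableSection (A : HermitianBundle m r E) (ν : Measure M) (s : ∀ p, E p) : Prop :=
  ∀ i, AEStronglyMeasurable (fun p => A.frame i p (s p)) (ν.restrict (A.dom i))

theorem aestronglyMeasurable_of_local (A : HermitianBundle m r E) {ν : Measure M} {β : Type*}
    [TopologicalSpace β] [TopologicalSpace.PseudoMetrizableSpace β] {f : M → β}
    (h : ∀ i, AEStronglyMeasurable f (ν.restrict (A.dom i))) : AEStronglyMeasurable f ν := by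
  obtain ⟨S, hS⟩ := A.exists_finset_cover
  have := (aestronglyMeasurable_iUnion_iff (μ := ν) (f := f)
    (s := fun i : S => A.dom i)).2 fun i => h i
  rwa [hS, Measure.restrict_univ] at this

theorem MeasurableSection.inner {A : HermitianBundle m r E} {ν : Measure M} {s s' : ∀ p, E p}
    (hs : A.MeasurableSection ν s) (hs' : A.MeasurableSection ν s') :
    AEStronglyMeasurable (fun p => inner ℂ (s p) (s' p)) ν := by
  refine A.aestronglyMeasurable_of_local fun i => ?_
  have := (hs i).inner (𝕜 := ℂ) (hs' i)
  simpa only [LinearIsometryEquiv.inner_map_map] using this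

theorem MeasurableSection.norm {A : HermitianBundle m r E} {ν : Measure M} {s : ∀ p, E p}
    (hs : A.MeasurableSection ν s) : AEStronglyMeasurable (fun p => ‖s p‖) ν := by
  refine A.aestronglyMeasurable_of_local fun i => ?_
  have := (hs i).norm
  simpa only [LinearIsometryEquiv.norm_map] using this

/-- The vector space of square integrable measurable sections. -/
def sqIntSubmodule (A : HermitianBundle m r E) (ν : Measure M) : Submodule ℂ (∀ p, E p) where
  carrier := {s | A.MeasurableSection ν s ∧ MemLp (fun p => ‖s p‖) 2 ν}
  zero_mem' := by
    refine ⟨fun i => ?_, ?_⟩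
    · simpa using aestronglyMeasurable_const
    · simp
  add_mem' := by
    rintro s s' ⟨hs, hs2⟩ ⟨hs', hs2'⟩
    have hm : A.MeasurableSection ν (s + s') := fun i => by
      simp only [Pi.add_apply, map_add]
      exact (hs i).add (hs' i)
    refine ⟨hm, (hs2.add hs2').mono hm.norm ?_⟩
    refine Eventually.of_forall fun p => ?_
    simp only [Pi.add_apply, norm_norm]
    exact (norm_add_le _ _).trans (le_abs_self _)
  smul_mem' := by
    rintro c s ⟨hs, hs2⟩
    refine ⟨fun i => ?_, ?_⟩
    · simp only [Pi.smul_apply, map_smul]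
      exact (hs i).const_smul c
    · simpa only [Pi.smul_apply, norm_smul] using hs2.const_mul ‖c‖

/-- Square integrable sections (before identification of sections which agree almost
everywhere). -/
def SqIntSection (A : HermitianBundle m r E) (ν : Measure M) : Type _ := A.sqIntSubmodule ν

variable {A : HermitianBundle m r E} {ν : Measure M}

instance : AddCommGroup (A.SqIntSection ν) := inferInstanceAs (AddCommGroup (A.sqIntSubmodule ν))

instance : Module ℂ (A.SqIntSection ν) := inferInstanceAs (Module ℂ (A.sqIntSubmodule ν))

/-- The section itself. -/
def SqIntSection.val (s : A.SqIntSection ν) : ∀ p, E p := Subtype.val s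

theorem SqIntSection.integrable_inner (s s' : A.SqIntSection ν) :
    Integrable (fun p => inner ℂ (s.val p) (s'.val p)) ν := by
  have h := s.2.2.integrable_mul s'.2.2
  refine h.mono (MeasurableSection.inner s.2.1 s'.2.1) (Eventually.of_forall fun p => ?_)
  refine (norm_inner_le_norm _ _).trans ?_
  simp [SqIntSection.val]

/-- The inner product `⟨s, s'⟩ = ∫ ⟨s p, s' p⟩ dν(p)`. -/
@[reducible]
def sqIntCore : PreInnerProductSpace.Core ℂ (A.SqIntSection ν) where
  inner s s' := ∫ p, inner ℂ (s.val p) (s'.val p) ∂ν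
  conj_inner_symm s s' := by
    rw [← integral_conj]
    simp
  re_inner_nonneg s := by
    have h := integral_re (𝕜 := ℂ) (s.integrable_inner s)
    refine le_of_le_of_eq ?_ h
    exact integral_nonneg fun p => inner_self_nonneg
  add_left s s' s'' := by
    rw [← integral_add (s.integrable_inner s'') (s'.integrable_inner s'')]
    refine integral_congr_ae (Eventually.of_forall fun p => ?_)
    exact inner_add_left _ _ _
  smul_left s s' c := by
    rw [← integral_const_mul]
    refine integral_congr_ae (Eventually.of_forall fun p => ?_)
    exact inner_smul_left _ _ _

instance : SeminormedAddCommGroup (A.SqIntSection ν) :=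
  @InnerProductSpace.Core.toSeminormedAddCommGroup ℂ _ _ _ _ sqIntCore

instance : InnerProductSpace ℂ (A.SqIntSection ν) := InnerProductSpace.ofCore sqIntCore

variable (A ν) in
/-- The Hilbert space `L²(M, E)`: sections of norm zero are identified with zero. -/
abbrev L2 : Type _ := SeparationQuotient (A.SqIntSection ν)

/-- `T` is the integral operator `s ↦ ∫ k(·, q) s(q) dν(q)` on `L²(M, E)`. -/
def HasKernel (T : A.L2 ν →L[ℂ] A.L2 ν) (k : ∀ p q, E q →L[ℂ] E p) : Prop :=
  ∀ s : A.SqIntSection ν, ∃ s' : A.SqIntSection ν,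
    T (SeparationQuotient.mk s) = SeparationQuotient.mk s' ∧
    ∀ᵐ p ∂ν, Integrable (fun q => k p q (s.val q)) ν ∧ s'.val p = ∫ q, k p q (s.val q) ∂ν

end L2

/-! ## The spaces of kernels -/

/-- The point of `M` with coordinates `x` in the chart `e`. -/
def chartPoint (e : OpenPartialHomeomorph M (EuclideanHalfSpace m)) (x : Fin m → ℝ) : M :=
  (e.extend (𝓡∂ m)).symm (WithLp.toLp 2 x)

/-- `x` are the coordinates of a point of `M` in the chart `e` and in the frame domain `i`. -/
def InChart (A : HermitianBundle m r E) (e : OpenPartialHomeomorph M (EuclideanHalfSpace m))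
    (i : A.Idx) (x : Fin m → ℝ) : Prop :=
  WithLp.toLp 2 x ∈ (e.extend (𝓡∂ m)).target ∧ chartPoint e x ∈ A.dom i

/-- The kernel `R`, `R μ p q : E q → E p`, as a matrix valued function of `t = 1/μ` and of local
coordinates of `p` and `q`. -/
def localKernel (A : HermitianBundle m r E) (R : ℝ → ∀ p q, E q →L[ℂ] E p)
    (e e' : OpenPartialHomeomorph M (EuclideanHalfSpace m)) (i i' : A.Idx) (y : Coord m → ℝ) :
    TypicalFiber r →L[ℂ] TypicalFiber r :=
  let p := chartPoint e fun k => y (Coord.z k)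
  let q := chartPoint e' fun k => y (Coord.w k)
  ((A.frame i p).toContinuousLinearEquiv : E p →L[ℂ] TypicalFiber r) ∘L
    (R (y Coord.t)⁻¹ p q) ∘L
    ((A.frame i' q).symm.toContinuousLinearEquiv : TypicalFiber r →L[ℂ] E q)

/-- The lift of the kernel `R` to the blowup of `[0, ∞) × M × M` along
`𝒞 = {t = 0, p = q ∈ ∂M}` and then along the lift of `𝒟 = {t = 0, p = q}` is polyhomogeneous with
index family `𝓔`, and has no singularity in the interior: this is required at the points of
`[0, ∞) × M × M` outside of `𝒞 ∪ 𝒟` in product coordinates, and at the points over `𝒞 ∪ 𝒟` in the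
projective coordinates. -/
def LiftsToPhg (A : HermitianBundle m r E) (𝓔 : Face → IndexSet)
    (R : ℝ → ∀ p q, E q →L[ℂ] E p) : Prop :=
  (∀ e ∈ IsManifold.maximalAtlas (𝓡∂ m) ∞ M, ∀ e' ∈ IsManifold.maximalAtlas (𝓡∂ m) ∞ M,
    ∀ (i i' : A.Idx) (y : Coord m → ℝ), 0 ≤ y Coord.t →
      A.InChart e i (fun k => y (Coord.z k)) → A.InChart e' i' (fun k => y (Coord.w k)) →
      ¬ (y Coord.t = 0 ∧
        chartPoint e (fun k => y (Coord.z k)) = chartPoint e' (fun k => y (Coord.w k))) →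
      PhgAt baseFace 𝓔 (A.localKernel R e e' i i') y) ∧
  (∀ e ∈ IsManifold.maximalAtlas (𝓡∂ m) ∞ M, ∀ (i i' : A.Idx), ∀ c ∈ blowupAtlas m,
    ∀ y ∈ c.points,
      A.InChart e i (fun k => c.blowdown y (Coord.z k)) →
      A.InChart e i' (fun k => c.blowdown y (Coord.w k)) →
      PhgAt c.face 𝓔 (fun x => A.localKernel R e e i i' (c.blowdown x)) y)

/-- The space `𝒜_phg^{ℓ,p}` of Schwartz kernels which lift to polyhomogeneous functions on the blowup
with leading order `-m + ℓ` at ff, leading order `-m + p` at td (infinite order vanishing for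
`p = ⊤`), index sets `ℕ₀` at lf and rf, infinite order vanishing at tf, and without a conormal
singularity along the diagonal. -/
def phgKernels (A : HermitianBundle m r E) (ℓ : ℝ) (p : WithTop ℝ) :
    Set (ℝ → ∀ p q, E q →L[ℂ] E p) :=
  {R | ∃ 𝓔 : Face → IndexSet, 𝓔 Face.lf = IndexSet.nat ∧ 𝓔 Face.rf = IndexSet.nat ∧
    𝓔 Face.tf = IndexSet.empty ∧
    (𝓔 Face.ff).HasLeadingOrder ((-(m : ℝ) + ℓ : ℝ) : WithTop ℝ) ∧
    (𝓔 Face.td).HasLeadingOrder (((-(m : ℝ) : ℝ) : WithTop ℝ) + p) ∧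
    A.LiftsToPhg 𝓔 R}

end HermitianBundle

/-! ## Hilbert–Schmidt operators -/

section HilbertSchmidt

variable {H : Type*} [NormedAddCommGroup H] [InnerProductSpace ℂ H]

/-- The square of the Hilbert–Schmidt norm: the supremum of `∑ ‖T e‖²` over finite orthonormal
systems. This is the sum of `‖T e‖²` over any orthonormal basis of a Hilbert space. -/
def hsNormSq (T : H →L[ℂ] H) : ℝ≥0∞ :=
  ⨆ S : {S : Finset H // Orthonormal ℂ ((↑) : S → H)}, ∑ e ∈ S.1, ‖T e‖ₑ ^ 2

/-- Hilbert–Schmidt operators. -/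
def IsHilbertSchmidt (T : H →L[ℂ] H) : Prop := hsNormSq T < ⊤

/-- The Hilbert–Schmidt norm. -/
def hsNorm (T : H →L[ℂ] H) : ℝ := Real.sqrt (hsNormSq T).toReal

end HilbertSchmidt

end

/-!
The Hilbert–Schmidt norm of an integral operator is controlled by the `L²` norm of its kernel
(`HermitianBundle.exists_hasKernel_hsNormSq_le`), so with `t = 1/μ` the claim is that
`∫∫ ‖R‖² = O(t^(2ℓ - m))`. This follows from a pointwise bound: near the diagonal, in a chart of `M`
and for points in the interior of `M`,
`‖R(p, q)‖ ≤ C t^(-m+ℓ+K) (t + |z - w|)^(-K)` for every `K ≥ 0`; away from the diagonal `R` is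
`O(t^N)` for all `N`, and for fixed `t > 0` it is bounded. By scaling, the square of the right hand
side has integral `O(t^m)` times `t^(2(ℓ - m))` as soon as `2 K > m`, since a smooth density is
dominated by Lebesgue measure in charts (`IsSmoothDensity.exists_nhds`, `setLIntegral_prod_le`). The
compactness of `M × M` then gives the global estimate
(`HermitianBundle.exists_lintegral_kernel_le`).

For the pointwise bound (`exists_bound_of_blowup`), a polyhomogeneous function is first bounded near
every point of a corner by the product of its leading powers (`PhgAt.eventually_norm_le`). If `ρ` is
the size of the functions defining `𝒞`, then ff, td and tf have defining functions which are
comparable to `ρ`, `(t + |z - w|)/ρ` and `t/(t + |z - w|)`; hence equal orders `a + K` at td and tf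
and the order `a = -m + ℓ` at ff give `ρ^a (t/ρ)^(a+K)`, and `t + |z - w| = O(ρ)`. That finitely
many of these local bounds suffice is the compactness of the fibres of the blow-down map. It is used
in the form that along every ultrafilter of points converging to `𝒞 ∪ 𝒟` the lifted points converge
in one of the projective coordinate systems (`exists_projective_limit`); bounds along all ultrafilters
give a uniform one (`exists_eventually_le_of_ultrafilter`).
-/

open Topology

/-! ### Bounds for polyhomogeneous functions on a model corner -/

/-- Powers of the logarithm are absorbed by lowering the exponent from `a` to `c`; the case `a = c`
only occurs without logarithms. -/
theorem exists_rpow_mul_abs_log_pow_le {a c : ℝ} {p : ℕ} (h : c ≤ a) (hp : c = a → p = 0) :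
    ∃ C : ℝ, 0 ≤ C ∧ ∀ x : ℝ, 0 < x → x ≤ 1 → x ^ a * |Real.log x| ^ p ≤ C * x ^ c := by
  rcases h.eq_or_lt with h | h
  · refine ⟨1, zero_le_one, fun x _ _ => ?_⟩
    simp [hp h, h]
  · rcases Nat.eq_zero_or_pos p with rfl | hp'
    · refine ⟨1, zero_le_one, fun x hx hx1 => ?_⟩
      simpa using Real.rpow_le_rpow_of_exponent_ge hx hx1 h.le
    have hq : (0 : ℝ) < p := by exact_mod_cast hp'
    set η : ℝ := (a - c) / p
    have hη : 0 < η := div_pos (sub_pos.2 h) hq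
    refine ⟨(1 / η) ^ p, by positivity, fun x hx hx1 => ?_⟩
    have h1 : |Real.log x| * x ^ η ≤ 1 / η := by
      have := Real.abs_log_mul_self_rpow_lt x η hx hx1 hη
      rw [abs_mul, abs_of_pos (Real.rpow_pos_of_pos hx η)] at this
      exact this.le
    have h2 : x ^ a = x ^ c * (x ^ η) ^ p := by
      rw [← Real.rpow_natCast, ← Real.rpow_mul hx.le, ← Real.rpow_add hx]
      congr 1
      simp only [η]
      field_simp
      ring
    calc x ^ a * |Real.log x| ^ p = (|Real.log x| * x ^ η) ^ p * x ^ c := by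
          rw [h2, mul_pow]; ring
      _ ≤ (1 / η) ^ p * x ^ c := by gcongr

/-- If `x i` is the smallest coordinate, a high power of `x i` compensates arbitrary powers of all
the other coordinates. -/
theorem pow_mul_prod_rpow_le {ι : Type*} [DecidableEq ι] {s : Finset ι} {x b c : ι → ℝ} {i : ι}
    (hi : i ∈ s) (hx : ∀ j ∈ s, 0 < x j) (hx1 : ∀ j ∈ s, x j ≤ 1) (hmin : ∀ j ∈ s, x i ≤ x j)
    {N : ℕ} (hN : ∑ j ∈ s, |b j| + ∑ j ∈ s, |c j| ≤ N) :
    x i ^ (N : ℝ) * ∏ j ∈ s.erase i, x j ^ b j ≤ ∏ j ∈ s, x j ^ c j := by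
  have hxi := hx i hi
  have h1 : ∏ j ∈ s.erase i, x j ^ b j ≤ x i ^ (-∑ j ∈ s, |b j|) := by
    calc ∏ j ∈ s.erase i, x j ^ b j ≤ ∏ j ∈ s.erase i, x i ^ (-|b j|) := by
          refine Finset.prod_le_prod (fun j hj => ?_) fun j hj => ?_
          · exact (Real.rpow_pos_of_pos (hx j (Finset.mem_of_mem_erase hj)) _).le
          · have hj := Finset.mem_of_mem_erase hj
            refine (Real.rpow_le_rpow_of_exponent_ge (hx j hj) (hx1 j hj)
              (neg_abs_le (b j))).trans ?_
            exact Real.rpow_le_rpow_of_nonpos hxi (hmin j hj) (neg_nonpos.2 (abs_nonneg _))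
      _ = x i ^ (-∑ j ∈ s.erase i, |b j|) := by
          rw [← Real.rpow_sum_of_pos hxi, Finset.sum_neg_distrib]
      _ ≤ x i ^ (-∑ j ∈ s, |b j|) := by
          refine Real.rpow_le_rpow_of_exponent_ge hxi (hx1 i hi) (neg_le_neg ?_)
          exact Finset.sum_le_sum_of_subset_of_nonneg (Finset.erase_subset _ _)
            fun _ _ _ => abs_nonneg _
  have h2 : x i ^ (∑ j ∈ s, |c j|) ≤ ∏ j ∈ s, x j ^ c j := by
    rw [Real.rpow_sum_of_pos hxi]
    refine Finset.prod_le_prod (fun j _ => (Real.rpow_pos_of_pos hxi _).le) fun j hj => ?_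
    refine (Real.rpow_le_rpow hxi.le (hmin j hj) (abs_nonneg _)).trans ?_
    exact Real.rpow_le_rpow_of_exponent_ge (hx j hj) (hx1 j hj) (le_abs_self _)
  calc x i ^ (N : ℝ) * ∏ j ∈ s.erase i, x j ^ b j
      ≤ x i ^ (N : ℝ) * x i ^ (-∑ j ∈ s, |b j|) :=
        mul_le_mul_of_nonneg_left h1 (Real.rpow_pos_of_pos hxi _).le
    _ = x i ^ (N - ∑ j ∈ s, |b j|) := by rw [← Real.rpow_add hxi, sub_eq_add_neg]
    _ ≤ x i ^ (∑ j ∈ s, |c j|) :=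
        Real.rpow_le_rpow_of_exponent_ge hxi (hx1 i hi) (by linarith)
    _ ≤ _ := h2

section Phg

variable {ι : Type*} [Fintype ι] [DecidableEq ι] {F : Type*} [NormedAddCommGroup F]
  [NormedSpace ℂ F]

/-- A polyhomogeneous function is bounded by the product of the leading powers at all faces
simultaneously. Each remainder estimate loses an uncontrolled power at the other faces, but the
expansion at the face closest to `x` has a remainder small enough to make up for this. For faces
with empty index set the exponent `c i` is arbitrary. -/
theorem PhgOn.exists_bound {E : ι → IndexSet} {W : Set (ι → ℝ)} {s : Finset ι}
    {u : (ι → ℝ) → F} (h : PhgOn E W s u) (c : ι → ℝ)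
    (hc : ∀ i ∈ s, (E i).HasLeadingOrder (c i)) :
    ∃ C : ℝ, 0 ≤ C ∧ ∀ x ∈ cornerInterior s W, (∀ i ∈ s, x i ≤ 1) →
      ‖u x‖ ≤ C * ∏ i ∈ s, x i ^ c i := by
  induction h with
  | @mk s u b a conormal coeff_indep coeff_phg remainder ih =>
  rcases s.eq_empty_or_nonempty with rfl | hs
  · obtain ⟨C, hC⟩ := conormal.2 []
    refine ⟨|C|, abs_nonneg C, fun x hx _ => ?_⟩
    simpa [bDerivs] using (hC x hx).trans (mul_le_mul_of_nonneg_right (le_abs_self C) (by simp))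
  -- the order up to which the expansions are used
  obtain ⟨N, hN⟩ := exists_nat_ge (∑ j ∈ s, |b j| + ∑ j ∈ s, |c j|)
  have key : ∀ i ∈ s, ∃ C : ℝ, 0 ≤ C ∧ ∀ x ∈ cornerInterior s W, (∀ j ∈ s, x j ≤ 1) →
      ‖u x‖ ≤ C * ∏ j ∈ s, x j ^ c j + C * (x i ^ (N : ℝ) * ∏ j ∈ s.erase i, x j ^ b j) := by
    intro i hi
    have hterm : ∀ g ∈ (E i).upTo N, ∃ C : ℝ, 0 ≤ C ∧ ∀ x ∈ cornerInterior s W,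
        (∀ j ∈ s, x j ≤ 1) →
        ‖(((x i : ℝ) : ℂ) ^ g.1 * ((Real.log (x i) : ℝ) : ℂ) ^ g.2) • a i g x‖ ≤
          C * ∏ j ∈ s, x j ^ c j := by
      intro g hg
      have hgE : g ∈ (E i).carrier := by
        have : g ∈ {g ∈ (E i).carrier | g.1.re ≤ N} := by simpa [IndexSet.upTo] using hg
        exact this.1
      obtain ⟨h1, h2⟩ := hc i hi g hgE
      obtain ⟨C₁, hC₁, hb₁⟩ := exists_rpow_mul_abs_log_pow_le (a := g.1.re) (c := c i) (p := g.2)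
        (by exact_mod_cast h1) (fun h => h2 (by exact_mod_cast h))
      obtain ⟨C₂, hC₂, hb₂⟩ := ih i hi g hgE fun j hj => hc j (Finset.mem_of_mem_erase hj)
      refine ⟨C₁ * C₂, mul_nonneg hC₁ hC₂, fun x hx hx1 => ?_⟩
      have hxi := hx.2 i hi
      have e1 := hb₁ (x i) hxi (hx1 i hi)
      have e2 := hb₂ x ⟨hx.1, fun j hj => hx.2 j (Finset.mem_of_mem_erase hj)⟩
        fun j hj => hx1 j (Finset.mem_of_mem_erase hj)
      rw [norm_smul, norm_mul, norm_pow, Complex.norm_cpow_eq_rpow_re_of_pos hxi,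
        Complex.norm_real, Real.norm_eq_abs, ← Finset.mul_prod_erase s _ hi]
      calc _ ≤ (C₁ * x i ^ c i) * (C₂ * ∏ j ∈ s.erase i, x j ^ c j) := by
            have := Real.rpow_pos_of_pos hxi (c i)
            gcongr
        _ = _ := by ring
    choose! Cg hCg hbg using hterm
    obtain ⟨C', hC'⟩ := (remainder i hi N).2 []
    refine ⟨(∑ g ∈ (E i).upTo N, Cg g) + |C'|,
      add_nonneg (Finset.sum_nonneg hCg) (abs_nonneg _), fun x hx hx1 => ?_⟩
    have hP : 0 ≤ ∏ j ∈ s, x j ^ c j :=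
      Finset.prod_nonneg fun j hj => (Real.rpow_pos_of_pos (hx.2 j hj) _).le
    have hQ : 0 ≤ x i ^ (N : ℝ) * ∏ j ∈ s.erase i, x j ^ b j :=
      mul_nonneg (Real.rpow_pos_of_pos (hx.2 i hi) _).le <| Finset.prod_nonneg fun j hj =>
        (Real.rpow_pos_of_pos (hx.2 j (Finset.mem_of_mem_erase hj)) _).le
    have hr := hC' x hx
    have hprod : ∏ j ∈ s, x j ^ Function.update b i (N : ℝ) j =
        x i ^ (N : ℝ) * ∏ j ∈ s.erase i, x j ^ b j := by
      rw [← Finset.mul_prod_erase s _ hi, Function.update_self]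
      congr 1
      refine Finset.prod_congr rfl fun j hj => ?_
      rw [Function.update_of_ne (Finset.ne_of_mem_erase hj)]
    rw [hprod] at hr
    simp only [bDerivs, List.foldr_nil] at hr
    have hsum := (norm_sum_le ((E i).upTo N) fun g =>
      (((x i : ℝ) : ℂ) ^ g.1 * ((Real.log (x i) : ℝ) : ℂ) ^ g.2) • a i g x).trans
      (Finset.sum_le_sum fun g hg => hbg g hg x hx hx1)
    rw [← Finset.sum_mul] at hsum
    have htri := norm_le_norm_sub_add (u x) (∑ g ∈ (E i).upTo N,
      (((x i : ℝ) : ℂ) ^ g.1 * ((Real.log (x i) : ℝ) : ℂ) ^ g.2) • a i g x)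
    have h3 : C' * (x i ^ (N : ℝ) * ∏ j ∈ s.erase i, x j ^ b j) ≤
        |C'| * (x i ^ (N : ℝ) * ∏ j ∈ s.erase i, x j ^ b j) :=
      mul_le_mul_of_nonneg_right (le_abs_self _) hQ
    have hS : 0 ≤ ∑ g ∈ (E i).upTo N, Cg g := Finset.sum_nonneg hCg
    nlinarith [mul_nonneg hS hQ, mul_nonneg (abs_nonneg C') hP]
  choose! C hC0 hC using key
  refine ⟨2 * ∑ i ∈ s, C i, by have := Finset.sum_nonneg hC0; positivity, fun x hx hx1 => ?_⟩
  -- the expansion is used at the face to which `x` is closest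
  obtain ⟨i, hi, hmin⟩ := s.exists_min_image x hs
  have h1 := hC i hi x hx hx1
  have h2 := pow_mul_prod_rpow_le hi hx.2 hx1 hmin hN
  have hP : 0 ≤ ∏ j ∈ s, x j ^ c j :=
    Finset.prod_nonneg fun j hj => (Real.rpow_pos_of_pos (hx.2 j hj) _).le
  have h3 : C i ≤ ∑ i ∈ s, C i := Finset.single_le_sum hC0 hi
  calc ‖u x‖ ≤ C i * ∏ j ∈ s, x j ^ c j + C i * ∏ j ∈ s, x j ^ c j :=
        h1.trans (by have := hC0 i hi; gcongr)
    _ = 2 * C i * ∏ j ∈ s, x j ^ c j := by ring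
    _ ≤ _ := by gcongr

variable {Φ : Type*} {face : ι → Option Φ} {E : Φ → IndexSet} {u : (ι → ℝ) → F} {y₀ : ι → ℝ}

/-- The bound by leading powers near a point of the corner. All hypersurfaces given by the
coordinates contribute a factor, including those which do not contain `y₀`. -/
theorem PhgAt.eventually_norm_le (h : PhgAt face E u y₀) (c : Φ → ℝ)
    (hc : ∀ f, (E f).HasLeadingOrder (c f)) (hy₀ : ∀ i, (face i).isSome → 0 ≤ y₀ i) :
    ∃ C : ℝ, 0 ≤ C ∧ ∀ᶠ y in 𝓝 y₀, (∀ i, (face i).isSome → 0 < y i) →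
      ‖u y‖ ≤ C * ∏ i, (face i).elim 1 fun f => y i ^ c f := by
  obtain ⟨δ, hδ, h⟩ := h
  set s := Finset.univ.filter fun i => (face i).isSome ∧ y₀ i = 0 with hs
  set d : ι → ℝ := fun i => (face i).elim 0 c with hd
  obtain ⟨C, hC0, hC⟩ := h.exists_bound d (by
    intro i hi
    obtain ⟨f, hf⟩ := Option.isSome_iff_exists.1 (Finset.mem_filter.1 hi).2.1
    simpa [hf, hd] using hc f)
  have hprod : ∀ y : ι → ℝ, ∏ i, (face i).elim 1 (fun f => y i ^ c f) = ∏ i, y i ^ d i := by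
    intro y
    refine Finset.prod_congr rfl fun i _ => ?_
    cases hf : face i <;> simp [hd, hf]
  have hne : ∀ i ∈ sᶜ, 0 < y₀ i ∨ d i = 0 := by
    intro i hi
    by_cases hf : (face i).isSome
    · refine Or.inl (lt_of_le_of_ne (hy₀ i hf) fun h0 => ?_)
      simp [hs, hf, h0.symm] at hi
    · right
      simp only [Bool.not_eq_true, Option.isSome_eq_false_iff, Option.isNone_iff_eq_none] at hf
      simp [hd, hf]
  set q := ∏ i ∈ sᶜ, y₀ i ^ d i with hq
  have hq0 : 0 < q := Finset.prod_pos fun i hi => by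
    rcases hne i hi with h0 | h0
    · exact Real.rpow_pos_of_pos h0 _
    · simp [h0]
  -- the factors at the hypersurfaces which do not contain `y₀` are bounded from below
  have hcont : ∀ᶠ y in 𝓝 y₀, q / 2 < ∏ i ∈ sᶜ, y i ^ d i ∧ ∀ i ∈ s, y i < 1 := by
    refine Filter.Eventually.and ?_ ?_
    · have ht : Tendsto (fun y : ι → ℝ => ∏ i ∈ sᶜ, y i ^ d i) (𝓝 y₀) (𝓝 q) := by
        refine tendsto_finsetProd _ fun i hi => ?_
        rcases hne i hi with h0 | h0
        · exact ((continuous_apply i).tendsto y₀).rpow_const (Or.inl h0.ne')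
        · simp [h0]
      exact ht.eventually (lt_mem_nhds (half_lt_self hq0))
    · refine (Finset.eventually_all s).2 fun i hi => ?_
      have h0 : y₀ i = 0 := (Finset.mem_filter.1 hi).2.2
      exact ((continuous_apply i).tendsto y₀).eventually (gt_mem_nhds (by rw [h0]; exact one_pos))
  refine ⟨C * (2 / q), by positivity, ?_⟩
  filter_upwards [hcont, Metric.ball_mem_nhds y₀ hδ] with y hy hyδ hypos
  have hb := hC y ⟨hyδ, fun i hi => hypos i (Finset.mem_filter.1 hi).2.1⟩ fun i hi => (hy.2 i hi).le
  rw [hprod, ← Finset.prod_mul_prod_compl s]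
  have hP : 0 ≤ ∏ j ∈ s, y j ^ d j := Finset.prod_nonneg fun j hj =>
    (Real.rpow_pos_of_pos (hypos j (Finset.mem_filter.1 hj).2.1) _).le
  calc ‖u y‖ ≤ C * ∏ j ∈ s, y j ^ d j := hb
    _ = C * (2 / q) * ((∏ j ∈ s, y j ^ d j) * (q / 2)) := by field_simp
    _ ≤ _ := by gcongr; exact hy.1.le

theorem PhgAt.continuousAt (h : PhgAt face E u y₀) (hy₀ : ∀ i, (face i).isSome → 0 < y₀ i) :
    ContinuousAt u y₀ := by
  obtain ⟨δ, hδ, ⟨_, _, hcon, _, _, _⟩⟩ := h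
  refine (hcon.1.mono fun x hx => ⟨hx, fun i hi => ?_⟩).continuousOn.continuousAt
    (Metric.ball_mem_nhds y₀ hδ)
  have hi := (Finset.mem_filter.1 hi).2
  exact absurd hi.2 (hy₀ i hi.1).ne'

end Phg

/-! ### Limits in projective coordinates of a blowup -/

section Blowup

variable {m : ℕ}

open Coord

theorem mem_centreD_z (k : Fin m) : (z k : Coord m) ∈ (centreD : Finset (Coord m)) := by
  simp [centreD]

theorem continuous_projBlowdown (I : Finset (Coord m)) (j : Coord m) (ε : ℝ) :
    Continuous (projBlowdown I j ε) := by
  refine continuous_pi fun i => ?_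
  unfold projBlowdown
  split_ifs <;> fun_prop

theorem continuous_fromDiff : Continuous (fromDiff : (Coord m → ℝ) → Coord m → ℝ) := by
  refine continuous_pi fun i => ?_
  rcases i with _ | i | i <;> simp only [fromDiff] <;> fun_prop

/-- Compactness of the fibres of the blow-down map: if the points `X a` converge along an
ultrafilter to a point of the centre `{x i = 0 for i ∈ I}`, then their lifts `Z a` converge in one
of the systems of projective coordinates, namely the one belonging to the dominating coordinate `j`,
whose sign is `ε`. The direction of the limit point is `Function.update y j ε`. -/
theorem exists_projective_limit {α : Type*} (𝓤 : Ultrafilter α) (I : Finset (Coord m))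
    {X : α → Coord m → ℝ} {x : Coord m → ℝ} (hX : ∀ i, Tendsto (fun a => X a i) 𝓤 (𝓝 (x i)))
    (hx : ∀ i ∈ I, x i = 0) (hne : ∀ᶠ a in 𝓤, ∃ i ∈ I, X a i ≠ 0) :
    ∃ j ∈ I, ∃ ε : ℝ, (ε = 1 ∨ ε = -1) ∧ ∃ (Z : α → Coord m → ℝ) (y : Coord m → ℝ),
      Tendsto Z 𝓤 (𝓝 y) ∧ y j = 0 ∧ (∀ i ∉ I, y i = x i) ∧
      (∀ i ∈ I, Tendsto (fun a => X a i / Z a j) 𝓤 (𝓝 (Function.update y j ε i))) ∧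
      ∀ᶠ a in 𝓤, projBlowdown I j ε (Z a) = X a ∧ 0 < Z a j ∧ Z a j = ε * X a j ∧
        (∀ i ∈ I, |X a i| ≤ Z a j) ∧ (∀ i ∈ I, i ≠ j → X a i = Z a j * Z a i) ∧
        (∀ i ∉ I, Z a i = X a i) ∧ ∀ i ∈ I, 0 < X a i → 0 < Z a i := by
  classical
  -- one coordinate dominates, with a fixed sign, on a set of the ultrafilter
  have hdom : ∃ j ∈ I, ∃ ε : ℝ, (ε = 1 ∨ ε = -1) ∧
      ∀ᶠ a in 𝓤, 0 < ε * X a j ∧ ∀ i ∈ I, |X a i| ≤ ε * X a j := by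
    have h1 : (⋃ g ∈ ((I ×ˢ ({1, -1} : Finset ℝ) : Finset (Coord m × ℝ)) : Set (Coord m × ℝ)),
        {a | 0 < g.2 * X a g.1 ∧ ∀ i ∈ I, |X a i| ≤ g.2 * X a g.1}) ∈ 𝓤 := by
      filter_upwards [hne] with a ⟨i, hi, hi0⟩
      obtain ⟨j, hj, hmax⟩ := I.exists_max_image (fun i => |X a i|) ⟨i, hi⟩
      have hpos : 0 < |X a j| := (abs_pos.2 hi0).trans_le (hmax i hi)
      simp only [Set.mem_iUnion]
      rcases abs_choice (X a j) with h | h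
      · exact ⟨(j, 1), by simp [hj], by simpa [h] using hpos, by simpa [h] using hmax⟩
      · exact ⟨(j, -1), by simp [hj], by simpa [h] using hpos, by simpa [h] using hmax⟩
    obtain ⟨⟨j, ε⟩, hg, h⟩ := (Ultrafilter.finite_biUnion_mem_iff (Finset.finite_toSet _)).1 h1
    simp only [Finset.coe_product, Set.mem_prod, Finset.mem_coe, Finset.mem_insert,
      Finset.mem_singleton] at hg
    exact ⟨j, hg.1, ε, hg.2, h⟩
  obtain ⟨j, hj, ε, hε, hdom⟩ := hdom
  have hε1 : ε * ε = 1 := by rcases hε with rfl | rfl <;> norm_num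
  set Z : α → Coord m → ℝ := fun a i =>
    if i = j then ε * X a j else if i ∈ I then X a i / (ε * X a j) else X a i with hZ
  have hZj : ∀ a, Z a j = ε * X a j := fun a => by simp [hZ]
  have hZI : ∀ a, ∀ i ∈ I, i ≠ j → Z a i = X a i / Z a j := fun a i hi hij => by
    simp [hZ, hi, hij]
  have hlim : ∀ i, ∃ l, Tendsto (fun a => Z a i) 𝓤 (𝓝 l) ∧ (i = j → l = 0) ∧
      (i ∉ I → l = x i) := by
    intro i
    by_cases hij : i = j
    · subst hij
      refine ⟨0, ?_, fun _ => rfl, fun h => absurd hj h⟩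
      have := (hX i).const_mul ε
      rw [hx i hj, mul_zero] at this
      simpa only [hZj] using this
    by_cases hi : i ∈ I
    · have hb : ∀ᶠ a in 𝓤, Z a i ∈ Set.Icc (-1 : ℝ) 1 := by
        filter_upwards [hdom] with a ⟨h0, h1⟩
        rw [hZI a i hi hij, hZj, Set.mem_Icc, ← abs_le, abs_div, abs_of_pos h0]
        exact div_le_one_of_le₀ (h1 i hi) h0.le
      obtain ⟨l, _, hl⟩ := isCompact_Icc.ultrafilter_le_nhds (𝓤.map fun a => Z a i)
        (le_principal_iff.2 hb)
      exact ⟨l, hl, fun h => absurd h hij, fun h => absurd hi h⟩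
    · exact ⟨x i, by simpa [hZ, hij, hi] using hX i, fun h => absurd h hij, fun _ => rfl⟩
  choose y hy hyj hyI using hlim
  refine ⟨j, hj, ε, hε, Z, y, tendsto_pi_nhds.2 hy, hyj j rfl, hyI, fun i hi => ?_, ?_⟩
  · by_cases hij : i = j
    · subst hij
      rw [Function.update_self]
      refine tendsto_const_nhds.congr' ?_
      filter_upwards [hdom] with a ⟨h0, _⟩
      rw [hZj, eq_div_iff h0.ne', ← mul_assoc, hε1, one_mul]
    · rw [Function.update_of_ne hij]
      exact (hy i).congr fun a => hZI a i hi hij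
  · filter_upwards [hdom] with a ⟨h0, h1⟩
    have h0' : 0 < Z a j := by rwa [hZj]
    have hmul : ∀ i ∈ I, i ≠ j → X a i = Z a j * Z a i := fun i hi hij => by
      rw [hZI a i hi hij, mul_div_cancel₀ _ h0'.ne']
    have hnot : ∀ i ∉ I, Z a i = X a i := fun i hi => by
      have hij : i ≠ j := fun h => hi (h ▸ hj)
      simp [hZ, hij, hi]
    refine ⟨?_, h0', hZj a, by simpa only [hZj] using h1, hmul, hnot, fun i hi hpos => ?_⟩
    · funext i
      unfold projBlowdown
      split_ifs with hij hi
      · rw [hij, hZj, ← mul_assoc, hε1, one_mul]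
      · exact (hmul i hi hij).symm
      · exact hnot i hi
    · by_cases hij : i = j
      · rwa [hij]
      · rw [hmul i hi hij] at hpos
        exact (pos_iff_pos_of_mul_pos hpos).1 h0'

variable [NeZero m]

theorem mem_centreC_z (k : Fin m) : (z k : Coord m) ∈ (centreC : Finset (Coord m)) := by
  simp [centreC]

theorem mem_centreC_t : (t : Coord m) ∈ (centreC : Finset (Coord m)) := by
  simp [centreC]

theorem mem_centreC_w : (w 0 : Coord m) ∈ (centreC : Finset (Coord m)) := by
  simp [centreC]

theorem notMem_centreC_w {k : Fin m} (hk : k ≠ 0) :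
    (w k : Coord m) ∉ (centreC : Finset (Coord m)) := by
  simp [centreC, hk]

theorem mem_centreD_t : (t : Coord m) ∈ (centreD : Finset (Coord m)) := by
  simp [centreD]

theorem notMem_centreD_w (k : Fin m) : (w k : Coord m) ∉ (centreD : Finset (Coord m)) := by
  simp [centreD]

theorem continuous_fromTangentialDiff :
    Continuous (fromTangentialDiff : (Coord m → ℝ) → Coord m → ℝ) := by
  refine continuous_pi fun i => ?_
  rcases i with _ | i | i <;> simp only [fromTangentialDiff] <;> (try split_ifs) <;> fun_prop

/-- The difference `z - w`, with the Euclidean norm. -/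
noncomputable def coordDiff (Y : Coord m → ℝ) : EuclideanSpace ℝ (Fin m) :=
  WithLp.toLp 2 fun k => Y (z k) - Y (w k)

theorem norm_coordDiff_le {Y : Coord m → ℝ} {r : ℝ} (hr : 0 ≤ r)
    (h : ∀ k : Fin m, |Y (z k) - Y (w k)| ≤ r) : ‖coordDiff Y‖ ≤ m * r := by
  have h1 := EuclideanSpace.norm_sq_eq (coordDiff Y)
  have h2 : ‖coordDiff Y‖ ^ 2 ≤ m * r ^ 2 := by
    rw [h1]
    refine (Finset.sum_le_sum (g := fun _ : Fin m => r ^ 2) fun k _ => ?_).trans (by simp)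
    rw [Real.norm_eq_abs, sq_abs]
    exact sq_le_sq' (abs_le.1 (h k)).1 (abs_le.1 (h k)).2
  have hm : (1 : ℝ) ≤ m := by exact_mod_cast NeZero.one_le
  refine le_of_sq_le_sq ?_ (by positivity)
  nlinarith [sq_nonneg r, mul_nonneg (sub_nonneg.2 hm) (sq_nonneg r)]

/-- The bound `ρ^a (t/ρ)^(a+K)` by the leading powers at ff, td and tf, where `ρ` is the size of the
functions defining `𝒞`, becomes a bound in terms of `t` and the distance `d` to the
diagonal. -/
theorem rpow_mul_div_rpow_le {a K D t ρ d : ℝ} (hK : 0 ≤ K) (ht : 0 < t) (hρ : 0 < ρ)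
    (hd : 0 ≤ d) (hD : 0 < D) (h : t + d ≤ D * ρ) :
    ρ ^ a * (t / ρ) ^ (a + K) ≤ D ^ K * (t ^ (a + K) * (t + d) ^ (-K)) := by
  have h1 : ρ ^ (-K) ≤ D ^ K * (t + d) ^ (-K) := by
    have := Real.rpow_le_rpow_of_nonpos (add_pos_of_pos_of_nonneg ht hd) h (neg_nonpos.2 hK)
    rw [Real.mul_rpow hD.le hρ.le, Real.rpow_neg hD.le] at this
    have hDK := Real.rpow_pos_of_pos hD K
    calc ρ ^ (-K) = D ^ K * ((D ^ K)⁻¹ * ρ ^ (-K)) := by field_simp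
      _ ≤ _ := by gcongr
  calc ρ ^ a * (t / ρ) ^ (a + K) = t ^ (a + K) * ρ ^ (-K) := by
        rw [Real.div_rpow ht.le hρ.le, show -K = a - (a + K) by ring, Real.rpow_sub hρ]
        ring
    _ ≤ t ^ (a + K) * (D ^ K * (t + d) ^ (-K)) := by gcongr
    _ = _ := by ring

/-- The orders `a` at ff, `n` at td and tf, `0` at lf and rf. -/
noncomputable def faceOrder (a n : ℝ) : Face → ℝ
  | Face.lf => 0
  | Face.rf => 0
  | Face.tf => n
  | Face.td => n
  | Face.ff => a

theorem prod_face_chartC (a n : ℝ) (j : Coord m) (ε : ℝ) (y : Coord m → ℝ) :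
    ∏ i, ((chartC j ε).face i).elim 1 (fun f => y i ^ faceOrder a n f) =
      y j ^ a * if t = j then 1 else y t ^ n := by
  have : ∀ i : Coord m, ((chartC j ε).face i).elim 1 (fun f => y i ^ faceOrder a n f) =
      (if i = j then y i ^ a else 1) * (if i = t then (if i = j then 1 else y i ^ n) else 1) := by
    intro i
    by_cases hij : i = j
    · simp [chartC, hij, faceOrder]
    · rcases i with _ | i | i <;> simp [chartC, hij, faceOrder, baseFace] <;> split_ifs <;> simp
  rw [Finset.prod_congr rfl fun i _ => this i, Finset.prod_mul_distrib]
  simp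

theorem prod_face_chartD (a n : ℝ) (j : Coord m) (ε : ℝ) (y : Coord m → ℝ) :
    ∏ i, ((chartD j ε).face i).elim 1 (fun f => y i ^ faceOrder a n f) =
      y j ^ n * if t = j then 1 else y t ^ n := by
  have : ∀ i : Coord m, ((chartD j ε).face i).elim 1 (fun f => y i ^ faceOrder a n f) =
      (if i = j then y i ^ n else 1) * (if i = t then (if i = j then 1 else y i ^ n) else 1) := by
    intro i
    by_cases hij : i = j
    · simp [chartD, hij, faceOrder]
    · rcases eq_or_ne i t with rfl | hit
      · simp [chartD, hij, faceOrder]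
      · simp [chartD, hij, hit, faceOrder]
  rw [Finset.prod_congr rfl fun i _ => this i, Finset.prod_mul_distrib]
  simp

theorem prod_face_chartCD (a n : ℝ) {j : Coord m} (hj : j ≠ w 0) (ε : ℝ) (y : Coord m → ℝ) :
    ∏ i, ((chartCD j ε).face i).elim 1 (fun f => y i ^ faceOrder a n f) =
      y j ^ n * y (w 0) ^ a * if t = j then 1 else y t ^ n := by
  have : ∀ i : Coord m, ((chartCD j ε).face i).elim 1 (fun f => y i ^ faceOrder a n f) =
      (if i = j then y i ^ n else 1) * (if i = w 0 then y i ^ a else 1) *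
      (if i = t then (if i = j then 1 else y i ^ n) else 1) := by
    intro i
    by_cases hij : i = j
    · simp [chartCD, hij, faceOrder, hj]
    · by_cases hiw : i = w 0
      · simp [chartCD, hiw, hj.symm, faceOrder]
      · rcases eq_or_ne i t with rfl | hit
        · simp [chartCD, hij, faceOrder]
        · simp [chartCD, hij, hiw, hit, faceOrder]
  rw [Finset.prod_congr rfl fun i _ => this i, Finset.prod_mul_distrib, Finset.prod_mul_distrib]
  simp

end Blowup

/-! ### The pointwise bound near the diagonal -/

section Blowup

variable {m : ℕ}

open Coord

/-- The inverse of `fromDiff`. -/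
noncomputable def toDiff (Y : Coord m → ℝ) : Coord m → ℝ
  | none => Y t
  | some (Sum.inl i) => Y (z i) - Y (w i)
  | some (Sum.inr i) => Y (w i)

theorem fromDiff_toDiff (Y : Coord m → ℝ) : fromDiff (toDiff Y) = Y := by
  funext i
  rcases i with _ | i | i <;> simp [fromDiff, toDiff]

variable [NeZero m]

/-- The inverse of `fromTangentialDiff`. -/
noncomputable def toTangentialDiff (Y : Coord m → ℝ) : Coord m → ℝ
  | none => Y t
  | some (Sum.inl i) => if i = 0 then Y (z 0) else Y (z i) - Y (w i)
  | some (Sum.inr i) => Y (w i)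

theorem fromTangentialDiff_toTangentialDiff (Y : Coord m → ℝ) :
    fromTangentialDiff (toTangentialDiff Y) = Y := by
  funext i
  rcases i with _ | i | i
  · simp [fromTangentialDiff, toTangentialDiff]
  · rcases eq_or_ne i 0 with rfl | hi
    · simp [fromTangentialDiff, toTangentialDiff]
    · simp [fromTangentialDiff, toTangentialDiff, hi]
  · simp [fromTangentialDiff, toTangentialDiff]

section Estimate

variable {F : Type*} [NormedAddCommGroup F] [NormedSpace ℂ F] {𝓔 : Face → IndexSet}
  {u : (Coord m → ℝ) → F} {Y₀ : Coord m → ℝ} {a K : ℝ} {𝓤 : Ultrafilter (Coord m → ℝ)}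

/-- Convergence of the lifts in one chart of the blowup gives the bound by leading powers. -/
theorem exists_chart_bound
    (hu : ∀ c ∈ blowupAtlas m, ∀ y ∈ c.points, c.blowdown y = Y₀ →
      PhgAt c.face 𝓔 (fun x => u (c.blowdown x)) y)
    {ord : Face → ℝ} (h𝓔 : ∀ f, (𝓔 f).HasLeadingOrder (ord f : ℝ))
    (h𝓤 : ↑𝓤 ≤ 𝓝 Y₀) {c : CornerChart m} (hc : c ∈ blowupAtlas m) (hcont : Continuous c.blowdown)
    {y : Coord m → ℝ} (hy : y ∈ c.points) {Z : (Coord m → ℝ) → Coord m → ℝ}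
    (hZ : Tendsto Z 𝓤 (𝓝 y)) (hpos : ∀ᶠ Y in 𝓤, ∀ i, (c.face i).isSome → 0 < Z Y i)
    (hZY : ∀ᶠ Y in 𝓤, c.blowdown (Z Y) = Y) :
    ∃ C : ℝ, 0 ≤ C ∧ ∀ᶠ Y in 𝓤,
      ‖u Y‖ ≤ C * ∏ i, (c.face i).elim 1 fun f => Z Y i ^ ord f := by
  have hyY : c.blowdown y = Y₀ := by
    have h1 : Tendsto (fun Y => c.blowdown (Z Y)) 𝓤 (𝓝 (c.blowdown y)) :=
      (hcont.tendsto y).comp hZ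
    exact tendsto_nhds_unique (h1.congr' hZY) h𝓤
  have hy0 : ∀ i, (c.face i).isSome → 0 ≤ y i := fun i hi =>
    ge_of_tendsto (tendsto_pi_nhds.1 hZ i) (hpos.mono fun Y h => (h i hi).le)
  obtain ⟨C, hC, hb⟩ := (hu c hc y hy hyY).eventually_norm_le ord h𝓔 hy0
  refine ⟨C, hC, ?_⟩
  filter_upwards [hZ.eventually hb, hpos, hZY] with Y h1 h2 h3
  have := h1 h2
  rwa [h3] at this

/-- The bound near a point of the diagonal over the interior of `M`, where td and tf are the only
hypersurfaces: `u` is `O(t^(a+K))` there. -/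
theorem exists_bound_of_interior (h0 : Y₀ t = 0) (hd : ∀ k, Y₀ (z k) = Y₀ (w k))
    (hb : 0 < Y₀ (w 0))
    (hu : ∀ c ∈ blowupAtlas m, ∀ y ∈ c.points, c.blowdown y = Y₀ →
      PhgAt c.face 𝓔 (fun x => u (c.blowdown x)) y)
    (hK : 0 ≤ K) (h𝓔 : ∀ f, (𝓔 f).HasLeadingOrder (faceOrder a (a + K) f : ℝ))
    (h𝓤 : ↑𝓤 ≤ 𝓝 Y₀) (ht : ∀ᶠ Y : Coord m → ℝ in 𝓤, 0 < Y t) :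
    ∃ C : ℝ, ∀ᶠ Y in 𝓤, ‖u Y‖ ≤ C * (Y t ^ (a + K) * (Y t + ‖coordDiff Y‖) ^ (-K)) := by
  have hlim : ∀ i, Tendsto (fun Y : Coord m → ℝ => Y i) 𝓤 (𝓝 (Y₀ i)) := fun i =>
    ((continuous_apply i).tendsto Y₀).mono_left h𝓤
  obtain ⟨j, hj, ε, hε, Z, y, hZ, hyj, hyI, -, hev⟩ := exists_projective_limit 𝓤 centreD
    (X := toDiff) (x := toDiff Y₀)
    (fun i => by
      rcases i with _ | i | i
      · exact hlim t
      · exact (hlim _).sub (hlim _)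
      · exact hlim _)
    (fun i hi => by
      rcases i with _ | i | i
      · exact h0
      · simp [toDiff, hd]
      · exact absurd hi (notMem_centreD_w i))
    (ht.mono fun Y hY => ⟨t, mem_centreD_t, hY.ne'⟩)
  have hc : chartD j ε ∈ blowupAtlas m := by
    refine Or.inr ⟨j, hj, ε, ?_, Or.inl rfl⟩
    rcases hε with h | h
    · exact Or.inl h
    · refine Or.inr ⟨h, fun hjt => ?_⟩
      obtain ⟨Y, h1, h2⟩ := (ht.and hev).exists
      have h3 := h2.2.2.1
      have h4 := h2.2.1
      rw [h3, h, hjt] at h4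
      simp only [toDiff] at h4
      linarith
  have hpos : ∀ᶠ Y in 𝓤, ∀ i, ((chartD j ε).face i).isSome → 0 < Z Y i := by
    filter_upwards [hev, ht] with Y ⟨_, h2, _, _, _, _, h7⟩ ht i hi
    by_cases hij : i = j
    · rwa [hij]
    · have hit : i = t := by
        by_contra hit
        simp [chartD, hij, hit] at hi
      rw [hit]
      exact h7 t mem_centreD_t ht
  have hcont : Continuous (chartD j ε).blowdown :=
    continuous_fromDiff.comp (continuous_projBlowdown _ _ _)
  obtain ⟨C, hC, hbd⟩ := exists_chart_bound hu h𝓔 h𝓤 hc hcont (y := y)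
    ⟨hyj, ge_of_tendsto (tendsto_pi_nhds.1 hZ t) (by
        filter_upwards [hev, ht] with Y h1 ht
        exact (h1.2.2.2.2.2.2 t mem_centreD_t ht).le),
      by rw [hyI _ (notMem_centreD_w 0)]; exact hb⟩
    hZ hpos (by
      filter_upwards [hev] with Y h1
      simp only [chartD]
      rw [h1.1, fromDiff_toDiff])
  refine ⟨C * 2 ^ K, ?_⟩
  have hsmall : ∀ᶠ Y : Coord m → ℝ in 𝓤, Y t + ‖coordDiff Y‖ ≤ 2 := by
    have h1 : Tendsto (fun Y : Coord m → ℝ => Y t + ‖coordDiff Y‖) 𝓤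
        (𝓝 (Y₀ t + ‖coordDiff Y₀‖)) := by
      have : Continuous fun Y : Coord m → ℝ => Y t + ‖coordDiff Y‖ := by
        unfold coordDiff
        fun_prop
      exact (this.tendsto Y₀).mono_left h𝓤
    have h2 : Y₀ t + ‖coordDiff Y₀‖ = 0 := by
      have : coordDiff Y₀ = 0 := by
        ext k
        simp [coordDiff, hd]
      rw [this, h0, norm_zero, add_zero]
    rw [h2] at h1
    exact (h1.eventually (gt_mem_nhds two_pos)).mono fun _ h => h.le
  filter_upwards [hbd, hev, ht, hsmall] with Y h1 h2 ht hs
  rw [prod_face_chartD] at h1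
  have hprod : (Z Y j ^ (a + K) * if t = j then 1 else Z Y t ^ (a + K)) = Y t ^ (a + K) := by
    split_ifs with htj
    · subst htj
      have hε' : ε = 1 := by
        rcases hε with h | h
        · exact h
        · have h3 := h2.2.2.1
          have h4 := h2.2.1
          rw [h3, h] at h4
          simp only [toDiff] at h4
          linarith
      rw [h2.2.2.1, hε', one_mul, mul_one]
      rfl
    · have h3 := h2.2.2.2.2.1 t mem_centreD_t htj
      have h4 := h2.2.2.2.2.2.2 t mem_centreD_t ht
      rw [← Real.mul_rpow h2.2.1.le h4.le, ← h3]
      rfl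
  rw [hprod] at h1
  have h5 := rpow_mul_div_rpow_le (a := a) hK ht one_pos (norm_nonneg (coordDiff Y)) two_pos
    (by linarith)
  rw [Real.one_rpow, one_mul, div_one] at h5
  calc ‖u Y‖ ≤ C * Y t ^ (a + K) := h1
    _ ≤ C * (2 ^ K * (Y t ^ (a + K) * (Y t + ‖coordDiff Y‖) ^ (-K))) := by gcongr
    _ = _ := by ring

/-- The bound near a point of the diagonal over `∂M`. Either the lifts converge to a point of ff
which is covered by the projective coordinates of the first blowup, or they converge to the lift of
the diagonal, and then coordinates of the second blowup are needed. -/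
theorem exists_bound_of_boundary (h0 : Y₀ t = 0) (hd : ∀ k, Y₀ (z k) = Y₀ (w k))
    (hb : Y₀ (w 0) = 0)
    (hu : ∀ c ∈ blowupAtlas m, ∀ y ∈ c.points, c.blowdown y = Y₀ →
      PhgAt c.face 𝓔 (fun x => u (c.blowdown x)) y)
    (hK : 0 ≤ K) (h𝓔 : ∀ f, (𝓔 f).HasLeadingOrder (faceOrder a (a + K) f : ℝ))
    (h𝓤 : ↑𝓤 ≤ 𝓝 Y₀) (hY : ∀ᶠ Y : Coord m → ℝ in 𝓤, 0 < Y t ∧ 0 < Y (z 0) ∧ 0 < Y (w 0)) :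
    ∃ C : ℝ, ∀ᶠ Y in 𝓤, ‖u Y‖ ≤ C * (Y t ^ (a + K) * (Y t + ‖coordDiff Y‖) ^ (-K)) := by
  have hlim : ∀ i, Tendsto (fun Y : Coord m → ℝ => Y i) 𝓤 (𝓝 (Y₀ i)) := fun i =>
    ((continuous_apply i).tendsto Y₀).mono_left h𝓤
  obtain ⟨j, hj, ε, hε, Z, y, hZ, hyj, hyI, hdir, hev⟩ := exists_projective_limit 𝓤 centreC
    (X := toTangentialDiff) (x := toTangentialDiff Y₀)
    (fun i => by
      rcases i with _ | i | i
      · exact hlim t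
      · rcases eq_or_ne i 0 with rfl | hi
        · simpa [toTangentialDiff] using hlim (z 0)
        · simpa [toTangentialDiff, hi] using (hlim _).sub (hlim _)
      · exact hlim _)
    (fun i hi => by
      rcases i with _ | i | i
      · exact h0
      · rcases eq_or_ne i 0 with rfl | hi
        · simp [toTangentialDiff, hd, hb]
        · simp [toTangentialDiff, hd, hi]
      · rcases eq_or_ne i 0 with rfl | hi'
        · simpa [toTangentialDiff] using hb
        · exact absurd hi (notMem_centreC_w hi'))
    (hY.mono fun Y hY => ⟨t, mem_centreC_t, hY.1.ne'⟩)
  have hXpos : ∀ Y : Coord m → ℝ, (0 < Y t ∧ 0 < Y (z 0) ∧ 0 < Y (w 0)) →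
      ∀ i ∈ (centreC : Finset (Coord m)), baseFace i ≠ none → 0 < toTangentialDiff Y i := by
    intro Y hY i hi hf
    rcases i with _ | i | i
    · exact hY.1
    · rcases eq_or_ne i 0 with rfl | hi
      · simpa [toTangentialDiff] using hY.2.1
      · simp [baseFace, hi] at hf
    · rcases eq_or_ne i 0 with rfl | hi
      · exact hY.2.2
      · simp [baseFace, hi] at hf
  have hsign : baseFace j ≠ none → ε = 1 := by
    intro hf
    rcases hε with h | h
    · exact h
    · obtain ⟨Y, h1, h2⟩ := (hY.and hev).exists
      have h3 := h2.2.2.1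
      have h4 := h2.2.1
      have h5 := hXpos Y h1 j hj hf
      rw [h3, h] at h4
      linarith
  by_cases hypt : y ∈ (chartC j ε).points
  -- here the defining function of ff is `ρ = Z Y j`, the largest `|X i|` for `i ∈ centreC`,
  -- where `X = toTangentialDiff Y`
  · have hc : chartC j ε ∈ blowupAtlas m := by
      refine Or.inl ⟨j, hj, ε, ?_, rfl⟩
      by_cases hf : baseFace j = none
      · exact hε.imp id fun h => ⟨h, hf⟩
      · exact Or.inl (hsign hf)
    have hpos : ∀ᶠ Y in 𝓤, ∀ i, ((chartC j ε).face i).isSome → 0 < Z Y i := by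
      filter_upwards [hev, hY] with Y ⟨_, h2, _, _, _, _, h7⟩ hY i hi
      by_cases hij : i = j
      · rwa [hij]
      · have hf : baseFace i ≠ none := by
          rintro h
          simp [chartC, hij, h] at hi
        have hiC : i ∈ (centreC : Finset (Coord m)) := by
          rcases i with _ | i | i
          · exact mem_centreC_t
          · exact mem_centreC_z i
          · rcases eq_or_ne i 0 with rfl | hi
            · exact mem_centreC_w
            · simp [baseFace, hi] at hf
        exact h7 i hiC (hXpos Y hY i hiC hf)
    have hcont : Continuous (chartC j ε).blowdown :=
      continuous_fromTangentialDiff.comp (continuous_projBlowdown _ _ _)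
    obtain ⟨C, hC, hbd⟩ := exists_chart_bound hu h𝓔 h𝓤 hc hcont hypt hZ hpos (by
      filter_upwards [hev] with Y h1
      simp only [chartC]
      rw [h1.1, fromTangentialDiff_toTangentialDiff])
    refine ⟨C * (1 + 2 * m) ^ K, ?_⟩
    filter_upwards [hbd, hev, hY] with Y h1 h2 hY
    rw [prod_face_chartC] at h1
    have hmax := h2.2.2.2.1
    have hprod : (Z Y j ^ a * if t = j then 1 else Z Y t ^ (a + K)) =
        Z Y j ^ a * (Y t / Z Y j) ^ (a + K) := by
      split_ifs with htj
      · subst htj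
        have h3 := h2.2.2.1
        rw [hsign (by simp [baseFace]), one_mul] at h3
        have h4 : Z Y t = Y t := h3
        rw [h4, div_self hY.1.ne', Real.one_rpow]
      · have h3 := h2.2.2.2.2.1 t mem_centreC_t htj
        have h4 : Y t = Z Y j * Z Y t := h3
        rw [h4, mul_div_cancel_left₀ _ h2.2.1.ne']
    have htρ : Y t ≤ Z Y j := (le_abs_self _).trans (hmax t mem_centreC_t)
    have hdiff : ‖coordDiff Y‖ ≤ m * (2 * Z Y j) := by
      refine norm_coordDiff_le (by linarith [h2.2.1]) fun k => ?_
      have h3 := hmax (z k) (mem_centreC_z k)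
      rcases eq_or_ne k 0 with rfl | hk
      · have h4 := hmax (w 0) mem_centreC_w
        simp only [toTangentialDiff, if_true] at h3 h4
        exact (abs_sub _ _).trans (by linarith)
      · simp only [toTangentialDiff, hk, if_false] at h3
        linarith [h2.2.1]
    rw [hprod] at h1
    have h5 := rpow_mul_div_rpow_le (a := a) (D := 1 + 2 * m) hK hY.1 h2.2.1
      (norm_nonneg (coordDiff Y)) (by positivity) (by linarith)
    calc ‖u Y‖ ≤ C * (Z Y j ^ a * (Y t / Z Y j) ^ (a + K)) := h1
      _ ≤ C * ((1 + 2 * m) ^ K * (Y t ^ (a + K) * (Y t + ‖coordDiff Y‖) ^ (-K))) := by gcongr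
      _ = _ := by ring
  -- the limit lies on the lift of the diagonal, which is blown up in turn
  · have hZnn : ∀ i ∈ (centreC : Finset (Coord m)), baseFace i ≠ none → 0 ≤ y i := by
      intro i hi hf
      refine ge_of_tendsto (tendsto_pi_nhds.1 hZ i) ?_
      filter_upwards [hev, hY] with Y h1 hY
      exact (h1.2.2.2.2.2.2 i hi (hXpos Y hY i hi hf)).le
    have hlift : (Function.update y j ε t = 0 ∧
        Function.update y j ε (z 0) = Function.update y j ε (w 0) ∧
        ∀ k : Fin m, k ≠ 0 → Function.update y j ε (z k) = 0) := by
      by_contra hn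
      exact hypt ⟨hyj, hZnn t mem_centreC_t (by simp [baseFace]),
        hZnn (z 0) (mem_centreC_z 0) (by simp [baseFace]),
        hZnn (w 0) mem_centreC_w (by simp [baseFace]), hn⟩
    set v := Function.update y j ε with hv
    have hvj : v j = ε := by simp [hv]
    have hε0 : ε ≠ 0 := by rcases hε with h | h <;> rw [h] <;> norm_num
    obtain ⟨hvt, hvzw, hvz⟩ := hlift
    -- the direction is normalized by its coordinate `j`, which must be `z 0` or `w 0`
    have hw1 : v (w 0) = 1 := by
      have hj' : j = z 0 ∨ j = w 0 := by
        rcases j with _ | k | k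
        · exact absurd (hvj.symm.trans hvt) hε0
        · rcases eq_or_ne k 0 with rfl | hk
          · exact Or.inl rfl
          · exact absurd (hvj.symm.trans (hvz k hk)) hε0
        · rcases eq_or_ne k 0 with rfl | hk
          · exact Or.inr rfl
          · exact absurd hj (notMem_centreC_w hk)
      rcases hj' with h | h
      · rw [← hvzw, ← h, hvj]
        exact hsign (by simp [h, baseFace])
      · rw [← h, hvj]
        exact hsign (by simp [h, baseFace])
    have hratio : ∀ i ∈ (centreC : Finset (Coord m)),
        Tendsto (fun Y => toTangentialDiff Y i / Y (w 0)) 𝓤 (𝓝 (v i)) := by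
      intro i hi
      have h1 := (hdir i hi).div (hdir (w 0) mem_centreC_w) (by rw [hw1]; exact one_ne_zero)
      rw [hw1, div_one] at h1
      refine h1.congr' ?_
      filter_upwards [hev] with Y h2
      exact div_div_div_cancel_right₀ h2.2.1.ne' _ _
    -- the projective coordinates, with the lift of the diagonal moved to the origin
    set X₂ : (Coord m → ℝ) → Coord m → ℝ := fun Y i => if i ∈ (centreD : Finset (Coord m)) then
      toTangentialDiff Y i / Y (w 0) - (if i = z 0 then 1 else 0) else Y i with hX₂
    have hX₂t : ∀ Y : Coord m → ℝ, X₂ Y t = Y t / Y (w 0) := fun Y => by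
      simp only [hX₂, mem_centreD_t, if_true, toTangentialDiff]
      simp
    have hX₂w : ∀ (Y : Coord m → ℝ) k, X₂ Y (w k) = Y (w k) := fun Y k => by
      simp only [hX₂, notMem_centreD_w, if_false]
    have hX₂z0 : ∀ Y : Coord m → ℝ, X₂ Y (z 0) = Y (z 0) / Y (w 0) - 1 := fun Y => by
      simp only [hX₂, mem_centreD_z, if_true, toTangentialDiff]
    have hX₂z : ∀ (Y : Coord m → ℝ) (k : Fin m), k ≠ 0 →
        X₂ Y (z k) = (Y (z k) - Y (w k)) / Y (w 0) := fun Y k hk => by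
      simp only [hX₂, mem_centreD_z, if_true, toTangentialDiff, hk, if_false]
      simp [hk]
    obtain ⟨j₂, hj₂, ε₂, hε₂, Z₂, y₂, hZ₂, hyj₂, hyI₂, -, hev₂⟩ := exists_projective_limit 𝓤
      centreD (X := X₂) (x := fun i => if i ∈ (centreD : Finset (Coord m)) then 0 else Y₀ i)
      (fun i => by
        rcases i with _ | k | k
        · simpa only [hX₂t, mem_centreD_t, if_true, hvt, toTangentialDiff]
            using hratio t mem_centreC_t
        · have h1 := hratio (z k) (mem_centreC_z k)
          rcases eq_or_ne k 0 with rfl | hk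
          · rw [hvzw, hw1] at h1
            have h2 := h1.sub_const 1
            rw [sub_self] at h2
            simpa only [hX₂z0, mem_centreD_z, if_true, toTangentialDiff] using h2
          · rw [hvz k hk] at h1
            simpa only [hX₂z _ k hk, mem_centreD_z, if_true, toTangentialDiff, hk, if_false]
              using h1
        · simpa only [hX₂w, notMem_centreD_w, if_false] using hlim (w k))
      (fun i hi => if_pos hi)
      (hY.mono fun Y hY => ⟨t, mem_centreD_t, by
        rw [hX₂t]
        exact (div_pos hY.1 hY.2.2).ne'⟩)
    have hj₂w : j₂ ≠ w 0 := fun h => notMem_centreD_w 0 (h ▸ hj₂)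
    have hsign₂ : j₂ = t → ε₂ = 1 := by
      intro hjt
      rcases hε₂ with h | h
      · exact h
      · obtain ⟨Y, h1, h2⟩ := (hY.and hev₂).exists
        have h3 := h2.2.2.1
        have h4 := h2.2.1
        have h5 := div_pos h1.1 h1.2.2
        rw [h3, h, hjt, hX₂t] at h4
        linarith
    have hc : chartCD j₂ ε₂ ∈ blowupAtlas m := by
      refine Or.inr ⟨j₂, hj₂, ε₂, ?_, Or.inr rfl⟩
      by_cases hjt : j₂ = t
      · exact Or.inl (hsign₂ hjt)
      · exact hε₂.imp id fun h => ⟨h, hjt⟩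
    have hZt : ∀ᶠ Y in 𝓤, 0 < Z₂ Y t := by
      filter_upwards [hev₂, hY] with Y h1 hY
      refine h1.2.2.2.2.2.2 t mem_centreD_t ?_
      rw [hX₂t]
      exact div_pos hY.1 hY.2.2
    have hpos : ∀ᶠ Y in 𝓤, ∀ i, ((chartCD j₂ ε₂).face i).isSome → 0 < Z₂ Y i := by
      filter_upwards [hev₂, hY, hZt] with Y ⟨_, h2, _, _, _, h6, h7⟩ hY hZt i hi
      by_cases hij : i = j₂
      · rwa [hij]
      by_cases hiw : i = w 0
      · rw [hiw, h6 _ (notMem_centreD_w 0), hX₂w]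
        exact hY.2.2
      · have hit : i = t := by
          by_contra hit
          simp [chartCD, hij, hiw, hit] at hi
        rwa [hit]
    have hcont : Continuous (chartCD j₂ ε₂).blowdown := by
      refine continuous_fromTangentialDiff.comp ((continuous_projBlowdown _ _ _).comp ?_)
      have h1 := continuous_projBlowdown (centreD : Finset (Coord m)) j₂ ε₂
      exact h1.update _ (continuous_const.add ((continuous_apply (z 0)).comp h1))
    obtain ⟨C, hC, hbd⟩ := exists_chart_bound hu h𝓔 h𝓤 hc hcont (y := y₂)
      ⟨hyj₂, ge_of_tendsto (tendsto_pi_nhds.1 hZ₂ t) (hZt.mono fun _ h => h.le),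
        by rw [hyI₂ _ (notMem_centreD_w 0), if_neg (notMem_centreD_w 0), hb]⟩
      hZ₂ hpos (by
        filter_upwards [hev₂, hY] with Y h1 hY
        simp only [chartCD]
        rw [h1.1]
        have hw := hY.2.2.ne'
        funext i
        rcases i with _ | k | k
        · simp [fromTangentialDiff, projBlowdown, mem_centreC_t, hX₂w, hX₂t,
            mul_div_cancel₀ _ hw]
        · rcases eq_or_ne k 0 with rfl | hk
          · simp [fromTangentialDiff, projBlowdown, mem_centreC_z, hX₂w, hX₂z0,
              mul_div_cancel₀ _ hw]
          · simp [fromTangentialDiff, projBlowdown, mem_centreC_z, hX₂w, hX₂z, hk,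
              mul_div_cancel₀ _ hw, notMem_centreC_w hk]
        · rcases eq_or_ne k 0 with rfl | hk
          · simp [fromTangentialDiff, projBlowdown, hX₂w]
          · simp [fromTangentialDiff, projBlowdown, hX₂w, hk, notMem_centreC_w hk])
    refine ⟨C * (1 + m) ^ K, ?_⟩
    -- now `w 0` is comparable to the defining function `ρ` of ff before the second blowup
    have hone : ∀ᶠ Y in 𝓤, ∀ i ∈ (centreD : Finset (Coord m)), |X₂ Y i| ≤ 1 := by
      have h1 := (tendsto_pi_nhds.1 hZ₂ j₂)
      rw [hyj₂] at h1
      filter_upwards [hev₂, h1.eventually (gt_mem_nhds one_pos)] with Y h2 h3 i hi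
      exact (h2.2.2.2.1 i hi).trans h3.le
    filter_upwards [hbd, hev₂, hY, hZt, hone] with Y h1 h2 hY hZt hone
    have hw0 := hY.2.2
    rw [prod_face_chartCD _ _ hj₂w, h2.2.2.2.2.2.1 _ (notMem_centreD_w 0), hX₂w] at h1
    have hprod : (Z₂ Y j₂ ^ (a + K) * Y (w 0) ^ a * if t = j₂ then 1 else Z₂ Y t ^ (a + K)) =
        Y (w 0) ^ a * (Y t / Y (w 0)) ^ (a + K) := by
      rw [← hX₂t]
      split_ifs with htj
      · have h3 := h2.2.2.1
        rw [hsign₂ htj.symm, one_mul, ← htj] at h3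
        rw [← htj, h3, mul_one, mul_comm]
      · have h3 := h2.2.2.2.2.1 t mem_centreD_t htj
        rw [h3, Real.mul_rpow h2.2.1.le hZt.le]
        ring
    rw [hprod] at h1
    have htw : Y t ≤ Y (w 0) := by
      have h3 := (le_abs_self _).trans (hone t mem_centreD_t)
      rwa [hX₂t, div_le_one hw0] at h3
    have hdiff : ‖coordDiff Y‖ ≤ m * Y (w 0) := by
      refine norm_coordDiff_le hw0.le fun k => ?_
      have h3 := hone (z k) (mem_centreD_z k)
      have h4 : Y (z k) - Y (w k) = X₂ Y (z k) * Y (w 0) := by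
        rcases eq_or_ne k 0 with rfl | hk
        · rw [hX₂z0]
          field_simp
        · rw [hX₂z _ _ hk]
          field_simp
      rw [h4, abs_mul, abs_of_pos hw0]
      exact mul_le_of_le_one_left hw0.le h3
    have h5 := rpow_mul_div_rpow_le (a := a) (D := 1 + m) hK hY.1 hw0
      (norm_nonneg (coordDiff Y)) (by positivity) (by linarith)
    calc ‖u Y‖ ≤ C * (Y (w 0) ^ a * (Y t / Y (w 0)) ^ (a + K)) := h1
      _ ≤ C * ((1 + m) ^ K * (Y t ^ (a + K) * (Y t + ‖coordDiff Y‖) ^ (-K))) := by gcongr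
      _ = _ := by ring

/-- A bound with a constant depending on the ultrafilter is a bound with a uniform constant. -/
theorem exists_eventually_le_of_ultrafilter {α : Type*} {l : Filter α} {f g : α → ℝ}
    (hg : ∀ᶠ x in l, 0 ≤ g x)
    (h : ∀ 𝓤 : Ultrafilter α, ↑𝓤 ≤ l → ∃ C : ℝ, ∀ᶠ x in 𝓤, f x ≤ C * g x) :
    ∃ C : ℝ, ∀ᶠ x in l, f x ≤ C * g x := by
  by_contra! hn
  have hne : NeBot (l ⊓ ⨅ n : ℕ, 𝓟 {x | n * g x < f x ∧ 0 ≤ g x}) := by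
    rw [inf_iInf]
    refine iInf_neBot_of_directed' ?_ fun n => ?_
    · refine directed_of_isDirected_le fun n k hnk => inf_le_inf_left _ (principal_mono.2 ?_)
      rintro x ⟨h1, h2⟩
      refine ⟨lt_of_le_of_lt ?_ h1, h2⟩
      gcongr
    · rw [inf_principal_neBot_iff]
      intro s hs
      have h1 := hn n
      obtain ⟨x, hx, hx'⟩ := (h1.and_eventually (hg.and hs)).exists
      exact ⟨x, hx'.2, hx, hx'.1⟩
  obtain ⟨𝓤, h𝓤⟩ := Ultrafilter.exists_le (l ⊓ ⨅ n : ℕ, 𝓟 {x | n * g x < f x ∧ 0 ≤ g x})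
  obtain ⟨C, hC⟩ := h 𝓤 (h𝓤.trans inf_le_left)
  obtain ⟨n, hn⟩ := exists_nat_ge C
  have h1 : ∀ᶠ x in 𝓤, n * g x < f x ∧ 0 ≤ g x :=
    le_principal_iff.1 (h𝓤.trans (inf_le_right.trans (iInf_le _ n)))
  obtain ⟨x, h2, h3, h4⟩ := (hC.and h1).exists
  have := mul_le_mul_of_nonneg_right hn h4
  linarith

/-- The bound near a point `Y₀` of the diagonal at `t = 0`, for a function whose lift to the blowup
is polyhomogeneous with leading order `a` at ff and vanishes to infinite order at td and tf. -/
theorem exists_bound_of_blowup (h0 : Y₀ t = 0) (hd : ∀ k, Y₀ (z k) = Y₀ (w k))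
    (hb : 0 ≤ Y₀ (w 0))
    (hu : ∀ c ∈ blowupAtlas m, ∀ y ∈ c.points, c.blowdown y = Y₀ →
      PhgAt c.face 𝓔 (fun x => u (c.blowdown x)) y)
    (hK : 0 ≤ K) (h𝓔 : ∀ f, (𝓔 f).HasLeadingOrder (faceOrder a (a + K) f : ℝ)) :
    ∃ C : ℝ, ∀ᶠ Y in 𝓝 Y₀, 0 < Y t → 0 < Y (z 0) → 0 < Y (w 0) →
      ‖u Y‖ ≤ C * (Y t ^ (a + K) * (Y t + ‖coordDiff Y‖) ^ (-K)) := by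
  set S : Set (Coord m → ℝ) := {Y | 0 < Y t ∧ 0 < Y (z 0) ∧ 0 < Y (w 0)} with hS
  obtain ⟨C, hC⟩ := exists_eventually_le_of_ultrafilter (l := 𝓝 Y₀ ⊓ 𝓟 S)
    (f := fun Y => ‖u Y‖) (g := fun Y => Y t ^ (a + K) * (Y t + ‖coordDiff Y‖) ^ (-K)) (by
      filter_upwards [mem_inf_of_right (mem_principal_self S)] with Y hY
      have := hY.1
      positivity) (fun 𝓤 h𝓤 => by
      have hY : ∀ᶠ Y : Coord m → ℝ in 𝓤, 0 < Y t ∧ 0 < Y (z 0) ∧ 0 < Y (w 0) :=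
        le_principal_iff.1 (h𝓤.trans inf_le_right)
      rcases hb.eq_or_lt with hb | hb
      · exact exists_bound_of_boundary h0 hd hb.symm hu hK h𝓔 (h𝓤.trans inf_le_left) hY
      · exact exists_bound_of_interior h0 hd hb hu hK h𝓔 (h𝓤.trans inf_le_left)
          (hY.mono fun _ h => h.1))
  refine ⟨C, ?_⟩
  rw [eventually_inf_principal] at hC
  filter_upwards [hC] with Y h h1 h2 h3 using h ⟨h1, h2, h3⟩

end Estimate

end Blowup

/-! ### Measurability of sections and kernels in unitary frames -/

theorem aestronglyMeasurable_of_countable_cover {X β J : Type*} [MeasurableSpace X]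
    [TopologicalSpace β] [TopologicalSpace.PseudoMetrizableSpace β] {μ : Measure X} {c : Set J}
    (hc : c.Countable) {P : J → Set X} (hP : ∀ x, ∃ j ∈ c, x ∈ P j) {f : X → β}
    (h : ∀ j ∈ c, AEStronglyMeasurable f (μ.restrict (P j))) : AEStronglyMeasurable f μ := by
  have := hc.to_subtype
  have h1 := (aestronglyMeasurable_iUnion_iff (μ := μ) (f := f) (s := fun j : c => P j)).2
    fun j => h j j.2
  have h2 : (⋃ j : c, P j) = Set.univ := Set.eq_univ_of_forall fun x => by
    obtain ⟨j, hj, hx⟩ := hP x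
    exact Set.mem_iUnion.2 ⟨⟨j, hj⟩, hx⟩
  rwa [h2, Measure.restrict_univ] at h1

section Frames

variable {M : Type*} {r : ℕ} {E : M → Type*} [∀ p, NormedAddCommGroup (E p)]
  [∀ p, InnerProductSpace ℂ (E p)]

/-- The kernel `k` as a matrix valued function, with respect to unitary frames `f` (at the first
point) and `f'` (at the second point). -/
noncomputable def frameMatrix (f f' : ∀ p, E p ≃ₗᵢ[ℂ] TypicalFiber r) (k : ∀ p q, E q →L[ℂ] E p)
    (x : M × M) : TypicalFiber r →L[ℂ] TypicalFiber r :=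
  ((f x.1).toContinuousLinearEquiv : E x.1 →L[ℂ] TypicalFiber r) ∘L (k x.1 x.2) ∘L
    ((f' x.2).symm.toContinuousLinearEquiv : TypicalFiber r →L[ℂ] E x.2)

variable (f f' : ∀ p, E p ≃ₗᵢ[ℂ] TypicalFiber r) (k : ∀ p q, E q →L[ℂ] E p)

theorem frameMatrix_apply (x : M × M) (v : E x.2) :
    frameMatrix f f' k x (f' x.2 v) = f x.1 (k x.1 x.2 v) := by
  simp [frameMatrix]

theorem norm_frameMatrix (x : M × M) : ‖frameMatrix f f' k x‖ = ‖k x.1 x.2‖ := by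
  refine le_antisymm (ContinuousLinearMap.opNorm_le_bound _ (norm_nonneg _) fun v => ?_)
    (ContinuousLinearMap.opNorm_le_bound _ (norm_nonneg _) fun v => ?_)
  · have h := frameMatrix_apply f f' k x ((f' x.2).symm v)
    rw [LinearIsometryEquiv.apply_symm_apply] at h
    rw [h, LinearIsometryEquiv.norm_map, ← (f' x.2).symm.norm_map v]
    exact (k x.1 x.2).le_opNorm _
  · rw [← (f x.1).norm_map, ← frameMatrix_apply f f' k x v, ← (f' x.2).norm_map v]
    exact (frameMatrix f f' k x).le_opNorm _

end Frames

namespace HermitianBundle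

variable {m : ℕ} [NeZero m] {M : Type*} [TopologicalSpace M]
  [ChartedSpace (EuclideanHalfSpace m) M] {r : ℕ} {E : M → Type*}
  [∀ p, NormedAddCommGroup (E p)] [∀ p, InnerProductSpace ℂ (E p)]

section Measurability

variable [SecondCountableTopology M] [MeasurableSpace M] [BorelSpace M]

/-- The index of a frame can be chosen measurably; countably many indices suffice. -/
theorem exists_measurable_index (A : HermitianBundle m r E) :
    ∃ ι : M → A.Idx, (∀ p, p ∈ A.dom (ι p)) ∧ ∃ c : Set A.Idx, c.Countable ∧ (∀ p, ι p ∈ c) ∧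
      ∀ i, MeasurableSet {p | ι p = i} := by
  classical
  rcases isEmpty_or_nonempty M with hM | ⟨⟨p₀⟩⟩
  · exact ⟨isEmptyElim, isEmptyElim, ∅, Set.countable_empty, isEmptyElim,
      fun i => by rw [Set.eq_empty_of_isEmpty {p : M | _}]; exact MeasurableSet.empty⟩
  obtain ⟨T, hT, hTU⟩ := TopologicalSpace.isOpen_iUnion_countable A.dom A.isOpen_dom
  have hcov : ∀ p, ∃ i ∈ T, p ∈ A.dom i := by
    intro p
    obtain ⟨i, hi⟩ := A.cover p
    have : p ∈ ⋃ i ∈ T, A.dom i := hTU ▸ Set.mem_iUnion.2 ⟨i, hi⟩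
    simpa using this
  obtain ⟨g, rfl⟩ := hT.exists_eq_range (let ⟨i, hi, _⟩ := hcov p₀; ⟨i, hi⟩)
  have hex : ∀ p, ∃ n, p ∈ A.dom (g n) := fun p => by simpa using hcov p
  refine ⟨fun p => g (Nat.find (hex p)), fun p => Nat.find_spec (hex p), Set.range g,
    Set.countable_range g, fun p => ⟨_, rfl⟩, fun i => ?_⟩
  have h1 : {p | g (Nat.find (hex p)) = i} =
      ⋃ n ∈ {n | g n = i}, {p | Nat.find (hex p) = n} := by
    ext p
    simp
  rw [h1]
  refine MeasurableSet.biUnion (Set.to_countable _) fun n _ => ?_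
  have h2 : {p | Nat.find (hex p) = n} = A.dom (g n) \ ⋃ k ∈ {k | k < n}, A.dom (g k) := by
    ext p
    simp [Nat.find_eq_iff]
  rw [h2]
  exact (A.isOpen_dom _).measurableSet.diff
    (MeasurableSet.biUnion (Set.to_countable _) fun k _ => (A.isOpen_dom _).measurableSet)

/-- A global measurable unitary frame `Φ`, which identifies measurable sections and kernels with
measurable functions. -/
theorem exists_measurable_frame (A : HermitianBundle m r E) :
    ∃ Φ : ∀ p, E p ≃ₗᵢ[ℂ] TypicalFiber r,
      (∀ (ν : Measure M) (s : ∀ p, E p),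
        A.MeasurableSection ν s ↔ AEStronglyMeasurable (fun p => Φ p (s p)) ν) ∧
      ∀ (ν : Measure M) [SFinite ν] (k : ∀ p q, E q →L[ℂ] E p),
        (∀ i i', AEStronglyMeasurable (frameMatrix (A.frame i) (A.frame i') k)
          ((ν.prod ν).restrict (A.dom i ×ˢ A.dom i'))) →
        AEStronglyMeasurable (frameMatrix Φ Φ k) (ν.prod ν) := by
  obtain ⟨ι, hι, c, hc, hιc, hmeas⟩ := A.exists_measurable_index
  have hdom : ∀ i, {p | ι p = i} ⊆ A.dom i := by
    rintro i p rfl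
    exact hι p
  refine ⟨fun p => A.frame (ι p) p, fun ν s => ⟨fun hs => ?_, fun hs i => ?_⟩, fun ν _ k hk => ?_⟩
  · refine aestronglyMeasurable_of_countable_cover hc (P := fun i => {p | ι p = i})
      (fun p => ⟨ι p, hιc p, rfl⟩) fun i _ => ?_
    refine ((hs i).mono_set (hdom i)).congr ?_
    refine ae_restrict_of_forall_mem (hmeas i) ?_
    rintro p rfl
    rfl
  · refine aestronglyMeasurable_of_countable_cover hc (P := fun i => {p | ι p = i})
      (fun p => ⟨ι p, hιc p, rfl⟩) fun j _ => ?_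
    rw [Measure.restrict_restrict (hmeas j)]
    have hsub : {p | ι p = j} ∩ A.dom i ⊆ A.dom j ∩ A.dom i :=
      Set.inter_subset_inter_left _ (hdom j)
    have hms : MeasurableSet ({p | ι p = j} ∩ A.dom i) :=
      (hmeas j).inter (A.isOpen_dom i).measurableSet
    have h1 := (((A.smooth j i).continuousOn.mono hsub).aestronglyMeasurable (μ := ν) hms)
    have h2 := hs.mono_measure (Measure.restrict_le_self (μ := ν) (s := {p | ι p = j} ∩ A.dom i))
    refine (ContinuousLinearMap.aestronglyMeasurable_comp₂
      (ContinuousLinearMap.id ℂ (TypicalFiber r →L[ℂ] TypicalFiber r)) h1 h2).congr ?_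
    refine ae_restrict_of_forall_mem hms ?_
    rintro p ⟨rfl, _⟩
    simp
  · refine aestronglyMeasurable_of_countable_cover (hc.prod hc)
      (P := fun i => {p | ι p = i.1} ×ˢ {p | ι p = i.2})
      (fun x => ⟨(ι x.1, ι x.2), ⟨hιc _, hιc _⟩, rfl, rfl⟩) fun i _ => ?_
    refine ((hk i.1 i.2).mono_set (Set.prod_mono (hdom _) (hdom _))).congr ?_
    refine ae_restrict_of_forall_mem ((hmeas _).prod (hmeas _)) ?_
    rintro ⟨p, q⟩ ⟨h1, h2⟩
    change ι p = _ at h1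
    change ι q = _ at h2
    simp only [frameMatrix, h1, h2]

end Measurability
end HermitianBundle

/-! ### Integral operators with square integrable kernels -/

namespace HermitianBundle

variable {m : ℕ} [NeZero m] {M : Type*} [TopologicalSpace M]
  [ChartedSpace (EuclideanHalfSpace m) M] {r : ℕ} {E : M → Type*}
  [∀ p, NormedAddCommGroup (E p)] [∀ p, InnerProductSpace ℂ (E p)] [CompactSpace M]
  [MeasurableSpace M] {A : HermitianBundle m r E} {ν : Measure M}

namespace SqIntSection

theorem enorm_sq (s : A.SqIntSection ν) : ‖s‖ₑ ^ 2 = ∫⁻ p, ‖s.val p‖ₑ ^ 2 ∂ν := by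
  have h1 : ‖s‖ ^ 2 = ∫ p, ‖s.val p‖ ^ 2 ∂ν := by
    rw [← inner_self_eq_norm_sq (𝕜 := ℂ)]
    change RCLike.re (∫ p, inner ℂ (s.val p) (s.val p) ∂ν) = _
    rw [← integral_re (s.integrable_inner s)]
    simp only [inner_self_eq_norm_sq]
  have h2 : Integrable (fun p => ‖s.val p‖ ^ 2) ν := by
    have := (s.integrable_inner s).re
    simpa only [inner_self_eq_norm_sq] using this
  rw [← ofReal_norm, ← ENNReal.ofReal_pow (norm_nonneg _), h1,
    ofReal_integral_eq_lintegral_ofReal h2 (Eventually.of_forall fun p => sq_nonneg _)]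
  refine lintegral_congr fun p => ?_
  rw [ENNReal.ofReal_pow (norm_nonneg _), ofReal_norm]

/-- A square integrable section as an element of `SqIntSection`. -/
noncomputable def ofMem (s : ∀ p, E p) (h : s ∈ A.sqIntSubmodule ν) : A.SqIntSection ν := ⟨s, h⟩

theorem add_val (s s' : A.SqIntSection ν) (p : M) : (s + s').val p = s.val p + s'.val p := rfl

theorem smul_val (c : ℂ) (s : A.SqIntSection ν) (p : M) : (c • s).val p = c • s.val p := rfl

theorem inner_def (s s' : A.SqIntSection ν) :
    inner ℂ s s' = ∫ p, inner ℂ (s.val p) (s'.val p) ∂ν := rfl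

theorem aemeasurable_enorm_sq (s : A.SqIntSection ν) :
    AEMeasurable (fun p => ‖s.val p‖ₑ ^ 2) ν := by
  have h := (MeasurableSection.norm s.2.1).aemeasurable.ennreal_ofReal
  simp only [ofReal_norm] at h
  exact h.pow_const 2

theorem mk_eq_mk {s s' : A.SqIntSection ν} (h : ∀ᵐ p ∂ν, s.val p = s'.val p) :
    (SeparationQuotient.mk s : A.L2 ν) = SeparationQuotient.mk s' := by
  rw [SeparationQuotient.mk_eq_mk, Metric.inseparable_iff, dist_eq_norm]
  have h1 : ‖s - s'‖ₑ ^ 2 = 0 := by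
    rw [enorm_sq, ← lintegral_zero (μ := ν)]
    refine lintegral_congr_ae ?_
    filter_upwards [h] with p hp
    have : (s - s').val p = s.val p - s'.val p := rfl
    rw [this, hp, sub_self]
    simp
  have h2 : ‖s - s'‖ₑ = 0 := by simpa using h1
  rwa [← ofReal_norm, ENNReal.ofReal_eq_zero, (norm_nonneg _).ge_iff_eq'] at h2

end SqIntSection

section Kernel

variable {k : ∀ p q, E q →L[ℂ] E p} {Φ : ∀ p, E p ≃ₗᵢ[ℂ] TypicalFiber r}

/-- For a point `p` such that `k p` is square integrable, the coordinates of `∫ k p q (s q)` are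
inner products with sections `κ a` which do not depend on `s`: the rows of the matrix of `k p`. -/
theorem exists_representers
    (hΦ : ∀ s : ∀ p, E p, A.MeasurableSection ν s ↔ AEStronglyMeasurable (fun p => Φ p (s p)) ν)
    {p : M} (hK : AEStronglyMeasurable (fun q => frameMatrix Φ Φ k (p, q)) ν)
    (hfin : ∫⁻ q, ‖k p q‖ₑ ^ 2 ∂ν < ⊤) :
    ∃ κ : Fin r → A.SqIntSection ν, (∀ a, ‖κ a‖ₑ ^ 2 ≤ ∫⁻ q, ‖k p q‖ₑ ^ 2 ∂ν) ∧
      ∀ s : A.SqIntSection ν, Integrable (fun q => k p q (s.val q)) ν ∧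
        ‖∫ q, k p q (s.val q) ∂ν‖ₑ ^ 2 = ∑ a, ‖inner ℂ (κ a) s‖ₑ ^ 2 := by
  set K : M → TypicalFiber r →L[ℂ] TypicalFiber r := fun q => frameMatrix Φ Φ k (p, q) with hKdef
  have hKnorm : ∀ q, ‖K q‖ = ‖k p q‖ := fun q => norm_frameMatrix Φ Φ k (p, q)
  have hKL : MemLp K 2 ν := by
    rw [memLp_two_iff_integrable_sq_norm hK]
    refine ⟨(hK.norm.pow 2), ?_⟩
    simp only [HasFiniteIntegral, enorm_pow, enorm_norm]
    simpa only [← ofReal_norm, hKnorm] using hfin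
  set e : Fin r → TypicalFiber r := fun a => EuclideanSpace.single a 1 with he
  have hadj : ∀ a, AEStronglyMeasurable (fun q => ContinuousLinearMap.adjoint (K q) (e a)) ν :=
    fun a => (ContinuousLinearMap.apply ℂ (TypicalFiber r) (e a)).continuous
      |>.comp_aestronglyMeasurable
      (ContinuousLinearMap.adjoint.continuous.comp_aestronglyMeasurable hK)
  have hadjn : ∀ a q, ‖ContinuousLinearMap.adjoint (K q) (e a)‖ ≤ ‖K q‖ := fun a q => by
    refine (ContinuousLinearMap.le_opNorm _ _).trans ?_
    rw [LinearIsometryEquiv.norm_map]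
    simp [he]
  have hmem : ∀ a, (fun q => (Φ q).symm (ContinuousLinearMap.adjoint (K q) (e a))) ∈
      A.sqIntSubmodule ν := fun a => by
    refine ⟨(hΦ _).2 (by simpa using hadj a), ?_⟩
    simp only [LinearIsometryEquiv.norm_map]
    exact hKL.norm.mono (hadj a).norm (Eventually.of_forall fun q => by simpa using hadjn a q)
  refine ⟨fun a => SqIntSection.ofMem _ (hmem a), fun a => ?_, fun s => ?_⟩
  · rw [SqIntSection.enorm_sq]
    refine lintegral_mono fun q => ?_
    gcongr
    have h1 : ‖(Φ q).symm (ContinuousLinearMap.adjoint (K q) (e a))‖ ≤ ‖k p q‖ := by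
      rw [LinearIsometryEquiv.norm_map, ← hKnorm]
      exact hadjn a q
    rw [← ofReal_norm, ← ofReal_norm]
    exact ENNReal.ofReal_le_ofReal h1
  have hs : AEStronglyMeasurable (fun q => Φ q (s.val q)) ν := (hΦ _).1 s.2.1
  have happ : ∀ q, K q (Φ q (s.val q)) = Φ p (k p q (s.val q)) := fun q =>
    frameMatrix_apply Φ Φ k (p, q) (s.val q)
  have hint : Integrable (fun q => Φ p (k p q (s.val q))) ν := by
    simp only [← happ]
    refine (hKL.norm.integrable_mul s.2.2).mono' (ContinuousLinearMap.aestronglyMeasurable_comp₂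
      (ContinuousLinearMap.id ℂ (TypicalFiber r →L[ℂ] TypicalFiber r)) hK hs)
      (Eventually.of_forall fun q => ?_)
    refine ((K q).le_opNorm _).trans (le_of_eq ?_)
    rw [LinearIsometryEquiv.norm_map]
    rfl
  have hint' : Integrable (fun q => k p q (s.val q)) ν := by
    have := ((Φ p).symm.toContinuousLinearEquiv : TypicalFiber r →L[ℂ] E p).integrable_comp hint
    simpa using this
  refine ⟨hint', ?_⟩
  have hcomm : Φ p (∫ q, k p q (s.val q) ∂ν) = ∫ q, Φ p (k p q (s.val q)) ∂ν :=
    ((Φ p).toContinuousLinearEquiv.integral_comp_comm _).symm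
  have hcoord : ∀ a, (Φ p (∫ q, k p q (s.val q) ∂ν)) a =
      inner ℂ (SqIntSection.ofMem _ (hmem a)) s := by
    intro a
    have h1 : (Φ p (∫ q, k p q (s.val q) ∂ν)) a =
        inner ℂ (e a) (Φ p (∫ q, k p q (s.val q) ∂ν)) := by
      simp [he, EuclideanSpace.inner_single_left]
    rw [h1, hcomm, ← integral_inner hint, SqIntSection.inner_def]
    refine integral_congr_ae (Eventually.of_forall fun q => ?_)
    change _ = inner ℂ ((Φ q).symm (ContinuousLinearMap.adjoint (K q) (e a))) (s.val q)
    rw [← (Φ q).inner_map_map, LinearIsometryEquiv.apply_symm_apply,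
      ContinuousLinearMap.adjoint_inner_left, happ]
  calc ‖∫ q, k p q (s.val q) ∂ν‖ₑ ^ 2 = ‖Φ p (∫ q, k p q (s.val q) ∂ν)‖ₑ ^ 2 := by
        rw [← ofReal_norm, ← ofReal_norm, LinearIsometryEquiv.norm_map]
    _ = ∑ a, ‖(Φ p (∫ q, k p q (s.val q) ∂ν)) a‖ₑ ^ 2 := by
        rw [← ofReal_norm, ← ENNReal.ofReal_pow (norm_nonneg _), EuclideanSpace.norm_sq_eq,
          ENNReal.ofReal_sum_of_nonneg fun _ _ => sq_nonneg _]
        simp only [ENNReal.ofReal_pow (norm_nonneg _), ofReal_norm]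
    _ = _ := by simp only [hcoord]

theorem sum_enorm_inner_sq_le {H : Type*} [SeminormedAddCommGroup H] [InnerProductSpace ℂ H]
    {ι : Type*} [Fintype ι] {v : ι → H} (hv : Orthonormal ℂ v) (x : H) :
    ∑ i, ‖inner ℂ (v i) x‖ₑ ^ 2 ≤ ‖x‖ₑ ^ 2 := by
  have h := hv.sum_inner_products_le (x := x) (s := Finset.univ)
  simp only [← ofReal_norm, ← ENNReal.ofReal_pow (norm_nonneg _)]
  rw [← ENNReal.ofReal_sum_of_nonneg fun _ _ => sq_nonneg _]
  exact ENNReal.ofReal_le_ofReal h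

/-- A square integrable kernel defines a Hilbert–Schmidt operator. The factor `r` appears since the
right hand side is the integral of the square of the operator norm of the kernel. The bound on
finite orthonormal systems is Bessel's inequality for the rows of the kernel. -/
theorem exists_hasKernel_hsNormSq_le [SecondCountableTopology M] [BorelSpace M] [SFinite ν]
    (hk : ∀ i i', AEStronglyMeasurable (frameMatrix (A.frame i) (A.frame i') k)
      ((ν.prod ν).restrict (A.dom i ×ˢ A.dom i')))
    (hfin : ∫⁻ x, ‖k x.1 x.2‖ₑ ^ 2 ∂(ν.prod ν) < ⊤) :
    ∃ T : A.L2 ν →L[ℂ] A.L2 ν, HasKernel T k ∧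
      hsNormSq T ≤ r * ∫⁻ x, ‖k x.1 x.2‖ₑ ^ 2 ∂(ν.prod ν) := by
  obtain ⟨Φ, hΦ, hΦK⟩ := A.exists_measurable_frame
  have hK := hΦK ν k hk
  set I : ENNReal := ∫⁻ x, ‖k x.1 x.2‖ₑ ^ 2 ∂(ν.prod ν) with hI
  have hkn : AEMeasurable (fun x : M × M => ‖k x.1 x.2‖ₑ ^ 2) (ν.prod ν) := by
    have := hK.enorm.pow_const 2
    simpa only [← ofReal_norm, norm_frameMatrix] using this
  set g : M → ENNReal := fun p => ∫⁻ q, ‖k p q‖ₑ ^ 2 ∂ν with hg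
  have hgI : ∫⁻ p, g p ∂ν = I := (lintegral_prod _ hkn).symm
  have hgm : AEMeasurable g ν := hkn.lintegral_prod_right'
  have hgood : ∀ᵐ p ∂ν, AEStronglyMeasurable (fun q => frameMatrix Φ Φ k (p, q)) ν ∧ g p < ⊤ :=
    hK.prodMk_left.and (ae_lt_top' hgm (hgI ▸ hfin.ne))
  -- for almost every `p` the kernel is square integrable in the second variable
  have hrep : ∀ᵐ p ∂ν, ∃ κ : Fin r → A.SqIntSection ν, (∀ a, ‖κ a‖ₑ ^ 2 ≤ g p) ∧
      ∀ s : A.SqIntSection ν, Integrable (fun q => k p q (s.val q)) ν ∧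
        ‖∫ q, k p q (s.val q) ∂ν‖ₑ ^ 2 = ∑ a, ‖inner ℂ (κ a) s‖ₑ ^ 2 := by
    filter_upwards [hgood] with p hp
    exact exists_representers (hΦ ν) hp.1 hp.2
  have hbound : ∀ s : A.SqIntSection ν,
      ∫⁻ p, ‖∫ q, k p q (s.val q) ∂ν‖ₑ ^ 2 ∂ν ≤ r * I * ‖s‖ₑ ^ 2 := by
    intro s
    calc ∫⁻ p, ‖∫ q, k p q (s.val q) ∂ν‖ₑ ^ 2 ∂ν ≤ ∫⁻ p, (r * ‖s‖ₑ ^ 2) * g p ∂ν := by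
          refine lintegral_mono_ae ?_
          filter_upwards [hrep] with p ⟨κ, hκ, hκs⟩
          rw [(hκs s).2]
          calc ∑ a, ‖inner ℂ (κ a) s‖ₑ ^ 2 ≤ ∑ _a : Fin r, ‖s‖ₑ ^ 2 * g p := by
                refine Finset.sum_le_sum fun a _ => ?_
                have h1 : ‖inner ℂ (κ a) s‖ₑ ≤ ‖κ a‖ₑ * ‖s‖ₑ := by
                  rw [← ofReal_norm, ← ofReal_norm, ← ofReal_norm,
                    ← ENNReal.ofReal_mul (norm_nonneg _)]
                  exact ENNReal.ofReal_le_ofReal (norm_inner_le_norm _ _)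
                calc ‖inner ℂ (κ a) s‖ₑ ^ 2 ≤ (‖κ a‖ₑ * ‖s‖ₑ) ^ 2 := by gcongr
                  _ = ‖s‖ₑ ^ 2 * ‖κ a‖ₑ ^ 2 := by rw [mul_pow, mul_comm]
                  _ ≤ _ := by gcongr; exact hκ a
            _ = (r * ‖s‖ₑ ^ 2) * g p := by simp [mul_assoc]
      _ = r * I * ‖s‖ₑ ^ 2 := by
          rw [lintegral_const_mul'' _ hgm, hgI]
          ring
  have hmem : ∀ s : A.SqIntSection ν,
      (fun p => ∫ q, k p q (s.val q) ∂ν) ∈ A.sqIntSubmodule ν := by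
    intro s
    have hs : AEStronglyMeasurable (fun q => Φ q (s.val q)) ν := (hΦ ν _).1 s.2.1
    have hm : A.MeasurableSection ν fun p => ∫ q, k p q (s.val q) ∂ν := by
      rw [hΦ]
      have h1 : AEStronglyMeasurable
          (fun x : M × M => frameMatrix Φ Φ k x (Φ x.2 (s.val x.2))) (ν.prod ν) :=
        ContinuousLinearMap.aestronglyMeasurable_comp₂
          (ContinuousLinearMap.id ℂ (TypicalFiber r →L[ℂ] TypicalFiber r)) hK hs.comp_snd
      refine h1.integral_prod_right'.congr (Eventually.of_forall fun p => ?_)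
      simp only [frameMatrix_apply]
      exact (Φ p).toContinuousLinearEquiv.integral_comp_comm _
    refine ⟨hm, ?_⟩
    rw [memLp_two_iff_integrable_sq_norm hm.norm]
    refine ⟨hm.norm.norm.pow 2, ?_⟩
    simp only [HasFiniteIntegral, enorm_pow, enorm_norm]
    exact (hbound s).trans_lt (ENNReal.mul_lt_top (ENNReal.mul_lt_top (by simp) hfin) (by simp))
  set S : A.SqIntSection ν → A.SqIntSection ν := fun s => SqIntSection.ofMem _ (hmem s) with hS
  have hSval : ∀ s p, (S s).val p = ∫ q, k p q (s.val q) ∂ν := fun s p => rfl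
  have hint : ∀ᵐ p ∂ν, ∀ s : A.SqIntSection ν, Integrable (fun q => k p q (s.val q)) ν := by
    filter_upwards [hrep] with p ⟨κ, _, h⟩ s
    exact (h s).1
  set L : A.SqIntSection ν →ₗ[ℂ] A.L2 ν :=
    { toFun := fun s => SeparationQuotient.mk (S s)
      map_add' := fun s s' => by
        rw [← SeparationQuotient.mk_add]
        refine SqIntSection.mk_eq_mk ?_
        filter_upwards [hint] with p hp
        rw [SqIntSection.add_val, hSval, hSval, hSval, ← integral_add (hp s) (hp s')]
        simp only [SqIntSection.add_val, map_add]
      map_smul' := fun c s => by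
        rw [RingHom.id_apply, ← SeparationQuotient.mk_smul]
        refine SqIntSection.mk_eq_mk (Eventually.of_forall fun p => ?_)
        rw [SqIntSection.smul_val, hSval, hSval, ← integral_smul]
        simp only [SqIntSection.smul_val, map_smul] } with hL
  have hrI : (r : ENNReal) * I < ⊤ := ENNReal.mul_lt_top (by simp) hfin
  have hLb : ∀ s, ‖L s‖ ≤ Real.sqrt ((r : ENNReal) * I).toReal * ‖s‖ := by
    intro s
    have h1 : ‖L s‖ = ‖S s‖ := SeparationQuotient.norm_mk (S s)
    have h2 := hbound s
    have h3 := SqIntSection.enorm_sq (S s)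
    simp only [hSval] at h3
    rw [← h3, ← ofReal_norm, ← ofReal_norm, ← ENNReal.ofReal_pow (norm_nonneg _),
      ← ENNReal.ofReal_pow (norm_nonneg _), ← ENNReal.ofReal_toReal hrI.ne,
      ← ENNReal.ofReal_mul ENNReal.toReal_nonneg, ENNReal.ofReal_le_ofReal_iff (by positivity)]
      at h2
    rw [h1]
    refine le_of_sq_le_sq ?_ (by positivity)
    rwa [mul_pow, Real.sq_sqrt ENNReal.toReal_nonneg]
  set T₀ : A.SqIntSection ν →L[ℂ] A.L2 ν := L.mkContinuous _ hLb
  set T : A.L2 ν →L[ℂ] A.L2 ν := SeparationQuotient.liftCLM T₀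
    fun x y hxy => (hxy.map T₀.continuous).eq with hT
  have hTmk : ∀ s, T (SeparationQuotient.mk s) = SeparationQuotient.mk (S s) := fun s => rfl
  refine ⟨T, fun s => ⟨S s, hTmk s, ?_⟩, iSup_le fun ⟨B, hB⟩ => ?_⟩
  · filter_upwards [hint] with p hp
    exact ⟨hp s, hSval s p⟩
  · have hsurj : ∀ e : A.L2 ν, ∃ s : A.SqIntSection ν, SeparationQuotient.mk s = e :=
      SeparationQuotient.surjective_mk
    choose σ hσ using hsurj
    have hTe : ∀ e : A.L2 ν, ‖T e‖ₑ ^ 2 = ∫⁻ p, ‖(S (σ e)).val p‖ₑ ^ 2 ∂ν := fun e => by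
      rw [← SqIntSection.enorm_sq, ← ofReal_norm, ← ofReal_norm]
      conv_lhs => rw [← hσ e, hTmk, SeparationQuotient.norm_mk]
    simp only [hTe]
    rw [← lintegral_finsetSum' _ fun e _ => SqIntSection.aemeasurable_enorm_sq _, ← hgI,
      ← lintegral_const_mul'' _ hgm]
    refine lintegral_mono_ae ?_
    filter_upwards [hrep] with p ⟨κ, hκ, hκs⟩
    calc ∑ e ∈ B, ‖(S (σ e)).val p‖ₑ ^ 2 = ∑ e ∈ B, ∑ a, ‖inner ℂ (κ a) (σ e)‖ₑ ^ 2 :=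
          Finset.sum_congr rfl fun e _ => (hκs (σ e)).2
      _ = ∑ a, ∑ e ∈ B, ‖inner ℂ (κ a) (σ e)‖ₑ ^ 2 := Finset.sum_comm
      _ ≤ ∑ _a : Fin r, g p := by
          refine Finset.sum_le_sum fun a _ => le_trans ?_ (hκ a)
          have h1 := sum_enorm_inner_sq_le hB (SeparationQuotient.mk (κ a) : A.L2 ν)
          have h2 : ‖(SeparationQuotient.mk (κ a) : A.L2 ν)‖ₑ = ‖κ a‖ₑ := by
            rw [← ofReal_norm, ← ofReal_norm, SeparationQuotient.norm_mk]
          rw [h2] at h1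
          refine le_trans (le_of_eq ?_) h1
          rw [← Finset.sum_coe_sort B]
          refine Finset.sum_congr rfl fun e _ => ?_
          have h3 : inner ℂ (e : A.L2 ν) (SeparationQuotient.mk (κ a)) =
              inner ℂ (σ e) (κ a) := by
            conv_lhs => rw [← hσ e]
            exact SeparationQuotient.inner_mk_mk _ _
          rw [h3, ← ofReal_norm, ← ofReal_norm, norm_inner_symm]
      _ = r * g p := by simp

end Kernel

end HermitianBundle

/-! ### Smooth densities and integrals in charts -/

section Integrals

variable {m : ℕ}

/-- The scaling `x = t x'`. -/
theorem lintegral_rpow_add_norm {t a K : ℝ} (ht : 0 < t) :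
    ∫⁻ x : EuclideanSpace ℝ (Fin m), ENNReal.ofReal ((t ^ (a + K) * (t + ‖x‖) ^ (-K)) ^ 2) =
      ENNReal.ofReal (t ^ (2 * a + m)) *
        ∫⁻ x : EuclideanSpace ℝ (Fin m), ENNReal.ofReal ((1 + ‖x‖) ^ (-(2 * K))) := by
  set f : EuclideanSpace ℝ (Fin m) → ENNReal := fun x => ENNReal.ofReal ((1 + ‖x‖) ^ (-(2 * K)))
  have hf : Measurable f := by
    have : Measurable fun x : EuclideanSpace ℝ (Fin m) => (1 + ‖x‖) ^ (-(2 * K)) := by fun_prop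
    exact this.ennreal_ofReal
  have h1 : ∀ x : EuclideanSpace ℝ (Fin m),
      ENNReal.ofReal ((t ^ (a + K) * (t + ‖x‖) ^ (-K)) ^ 2) =
        ENNReal.ofReal (t ^ (2 * a)) * f (t⁻¹ • x) := by
    intro x
    rw [← ENNReal.ofReal_mul (by positivity)]
    congr 1
    have h2 : t + ‖x‖ = t * (1 + ‖t⁻¹ • x‖) := by
      rw [norm_smul, Real.norm_of_nonneg (inv_pos.2 ht).le]
      field_simp
    set d := 1 + ‖t⁻¹ • x‖
    have hd : 0 < d := by positivity
    rw [h2, Real.mul_rpow ht.le hd.le, ← mul_assoc, ← Real.rpow_add ht, mul_pow,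
      ← Real.rpow_natCast, ← Real.rpow_natCast, ← Real.rpow_mul ht.le, ← Real.rpow_mul hd.le]
    congr 2
    · push_cast
      ring
    · push_cast
      ring
  simp_rw [h1]
  have hfs : Measurable fun x : EuclideanSpace ℝ (Fin m) => f (t⁻¹ • x) :=
    hf.comp (measurable_const_smul _)
  rw [lintegral_const_mul _ hfs]
  have h3 : ∫⁻ x : EuclideanSpace ℝ (Fin m), f (t⁻¹ • x) =
      ENNReal.ofReal (t ^ m) * ∫⁻ x, f x := by
    rw [← lintegral_map hf (measurable_const_smul t⁻¹),
      Measure.map_addHaar_smul _ (inv_pos.2 ht).ne', lintegral_smul_measure, smul_eq_mul]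
    congr 2
    simp [abs_of_pos ht]
  rw [h3, ← mul_assoc, ← ENNReal.ofReal_mul (by positivity), Real.rpow_add ht, Real.rpow_natCast]

theorem volume_setOf_coord_eq_zero [NeZero m] :
    volume {x : EuclideanSpace ℝ (Fin m) | x 0 = 0} = 0 := by
  set S : Submodule ℝ (EuclideanSpace ℝ (Fin m)) :=
    LinearMap.ker (EuclideanSpace.proj (𝕜 := ℝ) (0 : Fin m) :
      EuclideanSpace ℝ (Fin m) →L[ℝ] ℝ).toLinearMap with hS
  have h1 : S ≠ ⊤ := by
    intro h
    have : EuclideanSpace.single (0 : Fin m) (1 : ℝ) ∈ S := h ▸ Submodule.mem_top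
    simp [hS] at this
  have h2 : {x : EuclideanSpace ℝ (Fin m) | x 0 = 0} = S := by
    ext x
    simp [hS]
  rw [h2]
  exact Measure.addHaar_submodule _ S h1

/-- Over a coordinate domain, the square of the pointwise bound is integrated first with respect to
the second point, which gives a power of `t` independent of the first point. -/
theorem setLIntegral_prod_le {M : Type*} [MeasurableSpace M] {ν : Measure M} [SFinite ν]
    {U : Set M} {φ : M → EuclideanSpace ℝ (Fin m)} (hφ : AEMeasurable φ (ν.restrict U)) {C : NNReal}
    (hC : (ν.restrict U).map φ ≤ C • volume) {t a K : ℝ} (ht : 0 < t) :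
    ∫⁻ x in U ×ˢ U, ENNReal.ofReal ((t ^ (a + K) * (t + ‖φ x.1 - φ x.2‖) ^ (-K)) ^ 2) ∂(ν.prod ν) ≤
      C * ν U * (∫⁻ x : EuclideanSpace ℝ (Fin m), ENNReal.ofReal ((1 + ‖x‖) ^ (-(2 * K)))) *
        ENNReal.ofReal (t ^ (2 * a + m)) := by
  set f : EuclideanSpace ℝ (Fin m) → ENNReal := fun x =>
    ENNReal.ofReal ((t ^ (a + K) * (t + ‖x‖) ^ (-K)) ^ 2) with hfdef
  have hf : Measurable f := by
    have : Measurable fun x : EuclideanSpace ℝ (Fin m) =>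
      (t ^ (a + K) * (t + ‖x‖) ^ (-K)) ^ 2 := by fun_prop
    exact this.ennreal_ofReal
  rw [← Measure.prod_restrict]
  have hmeas : AEMeasurable (fun x : M × M => f (φ x.1 - φ x.2))
      ((ν.restrict U).prod (ν.restrict U)) :=
    hf.comp_aemeasurable (hφ.comp_fst.sub hφ.comp_snd)
  rw [lintegral_prod _ hmeas]
  have hinner : ∀ p, ∫⁻ q in U, f (φ p - φ q) ∂ν ≤ C * ∫⁻ x, f x := by
    intro p
    have hg : Measurable fun x => f (φ p - x) := hf.comp (measurable_const.sub measurable_id)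
    calc ∫⁻ q in U, f (φ p - φ q) ∂ν = ∫⁻ x, f (φ p - x) ∂((ν.restrict U).map φ) :=
          (lintegral_map' hg.aemeasurable hφ).symm
      _ ≤ ∫⁻ x, f (φ p - x) ∂(C • (volume : Measure (EuclideanSpace ℝ (Fin m)))) :=
          lintegral_mono' hC le_rfl
      _ = C * ∫⁻ x, f (φ p - x) := by
          rw [lintegral_smul_measure]
          rfl
      _ = C * ∫⁻ x, f x := by rw [lintegral_sub_left_eq_self]
  calc _ ≤ ∫⁻ _p in U, (C * ∫⁻ x, f x) ∂ν := lintegral_mono hinner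
    _ = C * (∫⁻ x, f x) * ν U := by rw [lintegral_const, Measure.restrict_apply_univ]
    _ = _ := by
        rw [hfdef, lintegral_rpow_add_norm ht]
        ring

end Integrals

section Density

variable {m : ℕ} [NeZero m] {M : Type*} [TopologicalSpace M]
  [ChartedSpace (EuclideanHalfSpace m) M] [MeasurableSpace M] [BorelSpace M] {ν : Measure M}

/-- Near every point the measure is dominated by Lebesgue measure in a chart; in particular the
boundary is a null set. -/
theorem IsSmoothDensity.exists_nhds (hν : IsSmoothDensity m ν)
    {e : OpenPartialHomeomorph M (EuclideanHalfSpace m)}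
    (he : e ∈ IsManifold.maximalAtlas (𝓡∂ m) ∞ M) {p₀ : M} (hp₀ : p₀ ∈ e.source) :
    ∃ U : Set M, IsOpen U ∧ p₀ ∈ U ∧ U ⊆ e.source ∧ ν U < ⊤ ∧
      AEMeasurable (e.extend (𝓡∂ m)) (ν.restrict U) ∧
      (∃ C : NNReal, (ν.restrict U).map (e.extend (𝓡∂ m)) ≤ C • volume) ∧
      ∀ᵐ p ∂(ν.restrict U), 0 < e.extend (𝓡∂ m) p 0 := by
  obtain ⟨ρ, hρ, -, hνρ⟩ := hν e he
  set φ := e.extend (𝓡∂ m) with hφ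
  have hsrc : φ.source = e.source := e.extend_source
  have hcont : ContinuousOn φ e.source := hsrc ▸ e.continuousOn_extend
  have hmaps : Set.MapsTo φ e.source φ.target := hsrc ▸ φ.mapsTo
  have hρc : ContinuousOn (fun p => ρ (φ p)) e.source := hρ.continuousOn.comp hcont hmaps
  set U : Set M := e.source ∩ ((fun p => ρ (φ p)) ⁻¹' Set.Iio (ρ (φ p₀) + 1)) ∩
    (e.source ∩ φ ⁻¹' Metric.ball (φ p₀) 1) with hU
  have hUo : IsOpen U := (hρc.isOpen_inter_preimage e.open_source isOpen_Iio).inter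
    (hcont.isOpen_inter_preimage e.open_source Metric.isOpen_ball)
  have hUs : U ⊆ e.source := fun p hp => hp.1.1
  have hbound : ∀ B ⊆ U, MeasurableSet B →
      ν B ≤ (Real.toNNReal (ρ (φ p₀) + 1) : ENNReal) * volume (φ '' B) := by
    intro B hB hBm
    rw [hνρ B hBm (hB.trans hUs), ← setLIntegral_const]
    refine setLIntegral_mono measurable_const ?_
    rintro _ ⟨p, hp, rfl⟩
    exact ENNReal.ofReal_le_ofReal (hB hp).1.2.le
  have hmeas : AEMeasurable φ (ν.restrict U) := (hcont.mono hUs).aemeasurable hUo.measurableSet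
  have hmap : (ν.restrict U).map φ ≤ Real.toNNReal (ρ (φ p₀) + 1) • volume := by
    refine Measure.le_iff.2 fun S hS => ?_
    rw [Measure.map_apply_of_aemeasurable hmeas hS, Measure.restrict_apply' hUo.measurableSet]
    have hm : MeasurableSet (φ ⁻¹' S ∩ U) := by
      have h1 := ((continuousOn_iff_continuous_domRestrict.1 (hcont.mono hUs)).measurable hS)
      have h2 := hUo.measurableSet.subtype_image h1
      convert h2 using 1
      ext p
      simp [and_comm]
    refine (hbound _ Set.inter_subset_right hm).trans ?_
    rw [Measure.smul_apply]
    change _ ≤ (Real.toNNReal (ρ (φ p₀) + 1) : ENNReal) * volume S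
    gcongr
    rintro _ ⟨p, hp, rfl⟩
    exact hp.1
  refine ⟨U, hUo, ⟨⟨hp₀, by simp⟩, hp₀, by simp⟩, hUs, ?_, hmeas, ⟨_, hmap⟩, ?_⟩
  · refine (hbound U le_rfl hUo.measurableSet).trans_lt (ENNReal.mul_lt_top (by simp) ?_)
    refine lt_of_le_of_lt (measure_mono ?_) (measure_ball_lt_top (x := φ p₀) (r := 1))
    rintro _ ⟨p, hp, rfl⟩
    exact hp.2.2
  · have h1 : ∀ᵐ x : EuclideanSpace ℝ (Fin m), x 0 ≠ 0 := by
      rw [ae_iff]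
      simpa using volume_setOf_coord_eq_zero (m := m)
    have h2 : ∀ᵐ x ∂((ν.restrict U).map φ), x 0 ≠ 0 :=
      ((Measure.absolutelyContinuous_of_le hmap).trans
        (Measure.smul_absolutelyContinuous)).ae_le h1
    filter_upwards [ae_of_ae_map hmeas h2] with p hp
    have h3 : 0 ≤ φ p 0 := (e p).2
    exact h3.lt_of_ne' hp

theorem IsSmoothDensity.isFiniteMeasure [CompactSpace M] [IsManifold (𝓡∂ m) ∞ M]
    (hν : IsSmoothDensity m ν) : IsFiniteMeasure ν := by
  refine ⟨isCompact_univ.measure_lt_top_of_nhdsWithin fun p _ => ?_⟩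
  obtain ⟨U, hU, hpU, -, hfin, -⟩ := hν.exists_nhds (IsManifold.chart_mem_maximalAtlas p)
    (mem_chart_source (EuclideanHalfSpace m) p)
  exact ⟨U, mem_nhdsWithin_of_mem_nhds (hU.mem_nhds hpU), hfin⟩

end Density

/-! ### Global estimates for the kernel -/

open Coord in
theorem prod_baseFace {m : ℕ} [NeZero m] (a n : ℝ) (y : Coord m → ℝ) :
    ∏ i, (baseFace i).elim 1 (fun f => y i ^ faceOrder a n f) = y t ^ n := by
  have : ∀ i : Coord m, (baseFace i).elim 1 (fun f => y i ^ faceOrder a n f) =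
      if i = t then y i ^ n else 1 := by
    intro i
    rcases i with _ | i | i <;> simp [faceOrder, baseFace] <;> split_ifs <;> simp
  rw [Finset.prod_congr rfl fun i _ => this i]
  simp

theorem setLIntegral_enorm_sq_le {M : Type*} [MeasurableSpace M] {ν : Measure M} {E : M → Type*}
    [∀ p, NormedAddCommGroup (E p)] [∀ p, InnerProductSpace ℂ (E p)] {O : Set (M × M)}
    {k : ∀ p q, E q →L[ℂ] E p} {f : M × M → ℝ}
    (h : ∀ᵐ x ∂((ν.prod ν).restrict O), ‖k x.1 x.2‖ ≤ f x) :
    ∫⁻ x in O, ‖k x.1 x.2‖ₑ ^ 2 ∂(ν.prod ν) ≤ ∫⁻ x in O, ENNReal.ofReal (f x ^ 2) ∂(ν.prod ν) := by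
  refine lintegral_mono_ae ?_
  filter_upwards [h] with x hx
  rw [← ofReal_norm, ← ENNReal.ofReal_pow (norm_nonneg _)]
  exact ENNReal.ofReal_le_ofReal (pow_le_pow_left₀ (norm_nonneg _) hx 2)

namespace HermitianBundle

variable {m : ℕ} [NeZero m] {M : Type*} [TopologicalSpace M]

/-- The coordinates of the point `(t, p, q)` of `[0, ∞) × M × M` in the charts `e` and `e'`. -/
noncomputable def coordsOf (e e' : OpenPartialHomeomorph M (EuclideanHalfSpace m)) (t : ℝ)
    (x : M × M) : Coord m → ℝ
  | none => t
  | some (Sum.inl k) => e.extend (𝓡∂ m) x.1 k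
  | some (Sum.inr k) => e'.extend (𝓡∂ m) x.2 k

variable {e e' : OpenPartialHomeomorph M (EuclideanHalfSpace m)}

theorem chartPoint_extend {p : M} (hp : p ∈ e.source) :
    chartPoint e (fun k => e.extend (𝓡∂ m) p k) = p :=
  e.extend_left_inv hp

theorem tendsto_coordsOf {t : ℝ} {x : M × M} (h1 : x.1 ∈ e.source) (h2 : x.2 ∈ e'.source) :
    Tendsto (fun z : ℝ × (M × M) => coordsOf e e' z.1 z.2) (𝓝 t ×ˢ 𝓝 x)
      (𝓝 (coordsOf e e' t x)) := by
  refine tendsto_pi_nhds.2 fun i => ?_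
  have hc1 := e.continuousAt_extend (I := 𝓡∂ m) h1
  have hc2 := e'.continuousAt_extend (I := 𝓡∂ m) h2
  rcases i with _ | k | k
  · exact tendsto_fst
  · have hk : Continuous fun v : EuclideanSpace ℝ (Fin m) => v k := by fun_prop
    exact (hk.tendsto _).comp (hc1.tendsto.comp ((continuous_fst.tendsto x).comp tendsto_snd))
  · have hk : Continuous fun v : EuclideanSpace ℝ (Fin m) => v k := by fun_prop
    exact (hk.tendsto _).comp (hc2.tendsto.comp ((continuous_snd.tendsto x).comp tendsto_snd))

theorem coordDiff_coordsOf (t : ℝ) (x : M × M) :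
    coordDiff (coordsOf e e' t x) = e.extend (𝓡∂ m) x.1 - e'.extend (𝓡∂ m) x.2 := rfl

variable
  [ChartedSpace (EuclideanHalfSpace m) M] {r : ℕ} {E : M → Type*}
  [∀ p, NormedAddCommGroup (E p)] [∀ p, InnerProductSpace ℂ (E p)]

theorem inChart_extend (A : HermitianBundle m r E) {i : A.Idx} {p : M} (hp : p ∈ e.source)
    (hi : p ∈ A.dom i) : A.InChart e i fun k => e.extend (𝓡∂ m) p k := by
  refine ⟨(e.extend (𝓡∂ m)).map_source (by rwa [e.extend_source]), ?_⟩
  rwa [chartPoint_extend hp]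

theorem localKernel_coordsOf (A : HermitianBundle m r E) (R : ℝ → ∀ p q, E q →L[ℂ] E p)
    (i i' : A.Idx) (t : ℝ) {x : M × M} (h1 : x.1 ∈ e.source) (h2 : x.2 ∈ e'.source) :
    A.localKernel R e e' i i' (coordsOf e e' t x) =
      frameMatrix (A.frame i) (A.frame i') (R t⁻¹) x := by
  have h : ∀ y : M × M, y = x → frameMatrix (A.frame i) (A.frame i') (R t⁻¹) y =
      frameMatrix (A.frame i) (A.frame i') (R t⁻¹) x := by
    rintro y rfl
    rfl
  exact h (chartPoint e fun k => e.extend (𝓡∂ m) x.1 k,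
    chartPoint e' fun k => e'.extend (𝓡∂ m) x.2 k)
    (Prod.ext (chartPoint_extend h1) (chartPoint_extend h2))

section Estimates

variable [CompactSpace M] [IsManifold (𝓡∂ m) ∞ M] [MeasurableSpace M] [BorelSpace M]
  [SecondCountableTopology M]
  {A : HermitianBundle m r E} {ν : Measure M} {R : ℝ → ∀ p q, E q →L[ℂ] E p} {𝓔 : Face → IndexSet}

theorem exists_product_nhds (hν : IsSmoothDensity m ν)
    {e e' : OpenPartialHomeomorph M (EuclideanHalfSpace m)}
    (he : e ∈ IsManifold.maximalAtlas (𝓡∂ m) ∞ M) (he' : e' ∈ IsManifold.maximalAtlas (𝓡∂ m) ∞ M)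
    {x₀ : M × M} (h1 : x₀.1 ∈ e.source) (h2 : x₀.2 ∈ e'.source) :
    ∃ O : Set (M × M), IsOpen O ∧ x₀ ∈ O ∧ (∀ x ∈ O, x.1 ∈ e.source ∧ x.2 ∈ e'.source) ∧
      ∀ᵐ x ∂((ν.prod ν).restrict O),
        0 < e.extend (𝓡∂ m) x.1 0 ∧ 0 < e'.extend (𝓡∂ m) x.2 0 := by
  have := hν.isFiniteMeasure
  obtain ⟨U, hU, hpU, hUs, -, -, -, hUae⟩ := hν.exists_nhds he h1
  obtain ⟨V, hV, hqV, hVs, -, -, -, hVae⟩ := hν.exists_nhds he' h2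
  refine ⟨U ×ˢ V, hU.prod hV, ⟨hpU, hqV⟩, fun x hx => ⟨hUs hx.1, hVs hx.2⟩, ?_⟩
  rw [← Measure.prod_restrict]
  exact (Measure.quasiMeasurePreserving_fst.ae hUae).and
    (Measure.quasiMeasurePreserving_snd.ae hVae)

/-- What holds in coordinates near a point of `[0, ∞) × M × M`, at positive `t` and in the interior
of `M`, holds for all small `t` and almost all pairs of points of `M`. -/
theorem exists_nhds_ae_coordsOf (hν : IsSmoothDensity m ν)
    {e e' : OpenPartialHomeomorph M (EuclideanHalfSpace m)}
    (he : e ∈ IsManifold.maximalAtlas (𝓡∂ m) ∞ M) (he' : e' ∈ IsManifold.maximalAtlas (𝓡∂ m) ∞ M)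
    {t₀ : ℝ} {x₀ : M × M} (h1 : x₀.1 ∈ e.source) (h2 : x₀.2 ∈ e'.source) {W : Set (M × M)}
    (hW : W ∈ 𝓝 x₀) {P : (Coord m → ℝ) → Prop}
    (hP : ∀ᶠ Y in 𝓝 (coordsOf e e' t₀ x₀), 0 < Y Coord.t → 0 < Y (Coord.z 0) →
      0 < Y (Coord.w 0) → P Y) :
    ∃ O ⊆ W, IsOpen O ∧ x₀ ∈ O ∧ ∀ᶠ t in 𝓝 t₀, 0 < t → ∀ᵐ x ∂((ν.prod ν).restrict O),
      x.1 ∈ e.source ∧ x.2 ∈ e'.source ∧ P (coordsOf e e' t x) := by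
  obtain ⟨O, hO, hxO, hOs, hOae⟩ := exists_product_nhds hν he he' h1 h2
  obtain ⟨p, hp, q, hq, hpq⟩ := eventually_prod_iff.1 ((tendsto_coordsOf h1 h2).eventually hP)
  obtain ⟨Q, hQ, hQo, hxQ⟩ := mem_nhds_iff.1 (inter_mem hW hq)
  refine ⟨O ∩ Q, fun x hx => (hQ hx.2).1, hO.inter hQo, ⟨hxO, hxQ⟩, hp.mono fun t ht htpos => ?_⟩
  filter_upwards [ae_restrict_of_ae_restrict_of_subset Set.inter_subset_left hOae,
    ae_restrict_mem (hO.inter hQo).measurableSet] with x hx hxO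
  exact ⟨(hOs x hxO.1).1, (hOs x hxO.1).2, hpq ht (hQ hxO.2).2 htpos hx.1 hx.2⟩

/-- Away from the diagonal at `t = 0` the kernel vanishes to infinite order at `t = 0`; it is
bounded near every point with `t > 0`. -/
theorem exists_nhds_norm_le (hν : IsSmoothDensity m ν) (hR : A.LiftsToPhg 𝓔 R) {a n : ℝ}
    (h𝓔 : ∀ f, (𝓔 f).HasLeadingOrder (faceOrder a n f : ℝ)) {t₀ : ℝ} (ht₀ : 0 ≤ t₀)
    {x₀ : M × M} (hx₀ : ¬ (t₀ = 0 ∧ x₀.1 = x₀.2)) :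
    ∃ O ∈ 𝓝 x₀, ∃ C : ℝ, 0 ≤ C ∧ ∀ᶠ t in 𝓝 t₀, 0 < t →
      ∀ᵐ x ∂((ν.prod ν).restrict O), ‖R t⁻¹ x.1 x.2‖ ≤ C * t ^ n := by
  set e := chartAt (EuclideanHalfSpace m) x₀.1
  set e' := chartAt (EuclideanHalfSpace m) x₀.2
  have he : e ∈ IsManifold.maximalAtlas (𝓡∂ m) ∞ M := IsManifold.chart_mem_maximalAtlas x₀.1
  have he' : e' ∈ IsManifold.maximalAtlas (𝓡∂ m) ∞ M := IsManifold.chart_mem_maximalAtlas x₀.2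
  have h1 : x₀.1 ∈ e.source := mem_chart_source _ _
  have h2 : x₀.2 ∈ e'.source := mem_chart_source _ _
  obtain ⟨i, hi⟩ := A.cover x₀.1
  obtain ⟨i', hi'⟩ := A.cover x₀.2
  have hphg := hR.1 e he e' he' i i' (coordsOf e e' t₀ x₀) ht₀ (A.inChart_extend h1 hi)
    (A.inChart_extend h2 hi') (by
      rintro ⟨h3, h4⟩
      refine hx₀ ⟨h3, ?_⟩
      exact (chartPoint_extend h1).symm.trans (h4.trans (chartPoint_extend h2)))
  obtain ⟨C, hC, hb⟩ := hphg.eventually_norm_le (faceOrder a n) h𝓔 (by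
    intro j hj
    rcases j with _ | k | k
    · exact ht₀
    · rcases eq_or_ne k 0 with rfl | hk
      · exact (e x₀.1).2
      · simp [baseFace, hk] at hj
    · rcases eq_or_ne k 0 with rfl | hk
      · exact (e' x₀.2).2
      · simp [baseFace, hk] at hj)
  obtain ⟨O, -, hO, hxO, hOb⟩ := exists_nhds_ae_coordsOf hν he he' h1 h2 univ_mem
    (P := fun Y => ‖A.localKernel R e e' i i' Y‖ ≤ C * Y Coord.t ^ n) (by
      filter_upwards [hb] with Y hY ht hz hw
      rw [prod_baseFace] at hY
      refine hY fun j hj => ?_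
      rcases j with _ | k | k
      · exact ht
      · rcases eq_or_ne k 0 with rfl | hk
        · exact hz
        · simp [baseFace, hk] at hj
      · rcases eq_or_ne k 0 with rfl | hk
        · exact hw
        · simp [baseFace, hk] at hj)
  refine ⟨O, hO.mem_nhds hxO, C, hC, hOb.mono fun t ht htpos => ?_⟩
  filter_upwards [ht htpos] with x ⟨hx1, hx2, hx⟩
  rwa [A.localKernel_coordsOf R i i' t hx1 hx2, norm_frameMatrix] at hx

theorem lintegral_kernel_lt_top (hν : IsSmoothDensity m ν) (hR : A.LiftsToPhg 𝓔 R) {a n : ℝ}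
    (h𝓔 : ∀ f, (𝓔 f).HasLeadingOrder (faceOrder a n f : ℝ)) {t : ℝ} (ht : 0 < t) :
    ∫⁻ x, ‖R t⁻¹ x.1 x.2‖ₑ ^ 2 ∂(ν.prod ν) < ⊤ := by
  have := hν.isFiniteMeasure
  rw [← setLIntegral_univ]
  refine isCompact_univ.induction_on (p := fun O =>
    ∫⁻ x in O, ‖R t⁻¹ x.1 x.2‖ₑ ^ 2 ∂(ν.prod ν) < ⊤) (by simp)
    (fun O O' h h' => (lintegral_mono_set h).trans_lt h')
    (fun O O' h h' => (lintegral_union_le _ _ _).trans_lt (ENNReal.add_lt_top.2 ⟨h, h'⟩)) ?_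
  intro x₀ _
  obtain ⟨O, hO, C, -, hOb⟩ := exists_nhds_norm_le hν hR h𝓔 ht.le (x₀ := x₀)
    (fun h => ht.ne' h.1)
  refine ⟨O, mem_nhdsWithin_of_mem_nhds hO, ?_⟩
  refine (setLIntegral_enorm_sq_le (hOb.self_of_nhds ht)).trans_lt ?_
  rw [setLIntegral_const]
  exact ENNReal.mul_lt_top (by simp) (measure_lt_top _ _)

/-- The local form of the Hilbert–Schmidt bound: the square of `t^(a+K) (t + |z - w|)^(-K)` has
integral `O(t^(2a+m))` if `2 K > m`. -/
theorem exists_nhds_lintegral_kernel_le (hν : IsSmoothDensity m ν) (hR : A.LiftsToPhg 𝓔 R)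
    {a K : ℝ} (hK : (m : ℝ) < 2 * K)
    (h𝓔 : ∀ f, (𝓔 f).HasLeadingOrder (faceOrder a (a + K) f : ℝ)) (x₀ : M × M) :
    ∃ O ∈ 𝓝 x₀, ∃ C : NNReal, ∀ᶠ t in 𝓝 (0 : ℝ), 0 < t →
      ∫⁻ x in O, ‖R t⁻¹ x.1 x.2‖ₑ ^ 2 ∂(ν.prod ν) ≤ C * ENNReal.ofReal (t ^ (2 * a + m)) := by
  have := hν.isFiniteMeasure
  have hK0 : 0 ≤ K := by
    have : (0 : ℝ) ≤ m := m.cast_nonneg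
    linarith
  by_cases hx₀ : x₀.1 = x₀.2
  · obtain ⟨p₀, q₀⟩ := x₀
    obtain rfl : p₀ = q₀ := hx₀
    set e := chartAt (EuclideanHalfSpace m) p₀
    have he : e ∈ IsManifold.maximalAtlas (𝓡∂ m) ∞ M := IsManifold.chart_mem_maximalAtlas p₀
    have h1 : p₀ ∈ e.source := mem_chart_source _ _
    obtain ⟨i, hi⟩ := A.cover p₀
    obtain ⟨C, hC⟩ := exists_bound_of_blowup (𝓔 := 𝓔) (u := A.localKernel R e e i i)
      (Y₀ := coordsOf e e 0 (p₀, p₀)) (a := a) (K := K) rfl (fun k => rfl) (e p₀).2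
      (fun c hc y hy hcy => by
        refine hR.2 e he i i c hc y hy ?_ ?_
        · rw [hcy]
          exact A.inChart_extend h1 hi
        · rw [hcy]
          exact A.inChart_extend h1 hi) hK0 h𝓔
    obtain ⟨U, hU, hpU, -, -, hφ, ⟨D, hD⟩, -⟩ := hν.exists_nhds he h1
    obtain ⟨O, hOU, hO, hxO, hOb⟩ := exists_nhds_ae_coordsOf hν he he (x₀ := (p₀, p₀)) h1 h1
      ((hU.prod hU).mem_nhds ⟨hpU, hpU⟩) hC
    set J : ENNReal := ∫⁻ x : EuclideanSpace ℝ (Fin m), ENNReal.ofReal ((1 + ‖x‖) ^ (-(2 * K)))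
    have hJ : J < ⊤ := finite_integral_one_add_norm (by simpa using hK)
    have hfin : ENNReal.ofReal (C ^ 2) * (D * ν U * J) < ⊤ :=
      ENNReal.mul_lt_top (by simp)
        (ENNReal.mul_lt_top (ENNReal.mul_lt_top (by simp) (measure_lt_top _ _)) hJ)
    refine ⟨O, hO.mem_nhds hxO, (ENNReal.ofReal (C ^ 2) * (D * ν U * J)).toNNReal, ?_⟩
    filter_upwards [hOb] with t ht htpos
    rw [ENNReal.coe_toNNReal hfin.ne]
    have hb : ∀ᵐ x ∂((ν.prod ν).restrict O), ‖R t⁻¹ x.1 x.2‖ ≤ C * (t ^ (a + K) *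
        (t + ‖e.extend (𝓡∂ m) x.1 - e.extend (𝓡∂ m) x.2‖) ^ (-K)) := by
      filter_upwards [ht htpos] with x ⟨hx1, hx2, hx⟩
      rwa [A.localKernel_coordsOf R i i t hx1 hx2, norm_frameMatrix, coordDiff_coordsOf] at hx
    calc _ ≤ _ := setLIntegral_enorm_sq_le hb
      _ ≤ ∫⁻ x in U ×ˢ U, ENNReal.ofReal (C ^ 2) * ENNReal.ofReal ((t ^ (a + K) *
          (t + ‖e.extend (𝓡∂ m) x.1 - e.extend (𝓡∂ m) x.2‖) ^ (-K)) ^ 2) ∂(ν.prod ν) := by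
          refine (lintegral_mono_set hOU).trans (le_of_eq ?_)
          refine lintegral_congr fun x => ?_
          rw [← ENNReal.ofReal_mul (sq_nonneg C), ← mul_pow]
      _ ≤ ENNReal.ofReal (C ^ 2) * (D * ν U * J * ENNReal.ofReal (t ^ (2 * a + m))) := by
          rw [lintegral_const_mul' _ _ (by simp)]
          gcongr
          exact setLIntegral_prod_le hφ hD htpos
      _ = _ := by ring
  · obtain ⟨O, hO, C, hC, hOb⟩ := exists_nhds_norm_le hν hR h𝓔 le_rfl (x₀ := x₀)
      (fun h => hx₀ h.2)
    have hfin : ENNReal.ofReal (C ^ 2) * (ν.prod ν) O < ⊤ :=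
      ENNReal.mul_lt_top (by simp) (measure_lt_top _ _)
    refine ⟨O, hO, (ENNReal.ofReal (C ^ 2) * (ν.prod ν) O).toNNReal, ?_⟩
    filter_upwards [hOb, gt_mem_nhds one_pos] with t ht ht1 htpos
    rw [ENNReal.coe_toNNReal hfin.ne]
    calc _ ≤ ∫⁻ _x in O, ENNReal.ofReal ((C * t ^ (a + K)) ^ 2) ∂(ν.prod ν) :=
          setLIntegral_enorm_sq_le (ht htpos)
      _ = ENNReal.ofReal ((C * t ^ (a + K)) ^ 2) * (ν.prod ν) O := setLIntegral_const _ _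
      _ ≤ ENNReal.ofReal (C ^ 2 * t ^ (2 * a + m)) * (ν.prod ν) O := by
          gcongr
          rw [mul_pow, ← Real.rpow_natCast (t ^ (a + K)), ← Real.rpow_mul htpos.le]
          gcongr ?_ * ?_
          refine Real.rpow_le_rpow_of_exponent_ge htpos ht1.le ?_
          push_cast
          linarith
      _ = _ := by
          rw [ENNReal.ofReal_mul (sq_nonneg C)]
          ring

theorem exists_lintegral_kernel_le (hν : IsSmoothDensity m ν) (hR : A.LiftsToPhg 𝓔 R)
    {a K : ℝ} (hK : (m : ℝ) < 2 * K)
    (h𝓔 : ∀ f, (𝓔 f).HasLeadingOrder (faceOrder a (a + K) f : ℝ)) :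
    ∃ C : NNReal, ∀ᶠ t in 𝓝 (0 : ℝ), 0 < t →
      ∫⁻ x, ‖R t⁻¹ x.1 x.2‖ₑ ^ 2 ∂(ν.prod ν) ≤ C * ENNReal.ofReal (t ^ (2 * a + m)) := by
  simp_rw [← setLIntegral_univ (μ := ν.prod ν)]
  refine isCompact_univ.induction_on (p := fun O => ∃ C : NNReal, ∀ᶠ t in 𝓝 (0 : ℝ), 0 < t →
    ∫⁻ x in O, ‖R t⁻¹ x.1 x.2‖ₑ ^ 2 ∂(ν.prod ν) ≤ C * ENNReal.ofReal (t ^ (2 * a + m)))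
    ⟨0, by simp⟩ ?_ ?_ ?_
  · rintro O O' h ⟨C, hC⟩
    exact ⟨C, hC.mono fun t ht htpos => (lintegral_mono_set h).trans (ht htpos)⟩
  · rintro O O' ⟨C, hC⟩ ⟨C', hC'⟩
    refine ⟨C + C', ?_⟩
    filter_upwards [hC, hC'] with t h h' htpos
    refine (lintegral_union_le _ _ _).trans ((add_le_add (h htpos) (h' htpos)).trans ?_)
    rw [ENNReal.coe_add, add_mul]
  · intro x₀ _
    obtain ⟨O, hO, h⟩ := exists_nhds_lintegral_kernel_le hν hR hK h𝓔 x₀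
    exact ⟨O, mem_nhdsWithin_of_mem_nhds hO, h⟩

theorem aestronglyMeasurable_frameMatrix (hν : IsSmoothDensity m ν) (hR : A.LiftsToPhg 𝓔 R)
    {t : ℝ} (ht : 0 < t) (i i' : A.Idx) :
    AEStronglyMeasurable (frameMatrix (A.frame i) (A.frame i') (R t⁻¹))
      ((ν.prod ν).restrict (A.dom i ×ˢ A.dom i')) := by
  have := hν.isFiniteMeasure
  have hloc : ∀ x₀ ∈ A.dom i ×ˢ A.dom i', ∃ O ∈ 𝓝 x₀,
      AEStronglyMeasurable (frameMatrix (A.frame i) (A.frame i') (R t⁻¹))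
        ((ν.prod ν).restrict O) := by
    intro x₀ hx₀
    set e := chartAt (EuclideanHalfSpace m) x₀.1
    set e' := chartAt (EuclideanHalfSpace m) x₀.2
    have he : e ∈ IsManifold.maximalAtlas (𝓡∂ m) ∞ M := IsManifold.chart_mem_maximalAtlas x₀.1
    have he' : e' ∈ IsManifold.maximalAtlas (𝓡∂ m) ∞ M := IsManifold.chart_mem_maximalAtlas x₀.2
    obtain ⟨O, hO, hxO, hOs, hOae⟩ := exists_product_nhds hν he he' (x₀ := x₀)
      (mem_chart_source _ _) (mem_chart_source _ _)
    have hdo : IsOpen (A.dom i ×ˢ A.dom i') := (A.isOpen_dom i).prod (A.isOpen_dom i')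
    set B : Set (M × M) := {x | 0 < e.extend (𝓡∂ m) x.1 0 ∧ 0 < e'.extend (𝓡∂ m) x.2 0}
    have hcoord : ∀ e : OpenPartialHomeomorph M (EuclideanHalfSpace m),
        ContinuousOn (fun p => e.extend (𝓡∂ m) p 0) e.source := fun e =>
      (EuclideanSpace.proj (𝕜 := ℝ) (0 : Fin m)).continuous.comp_continuousOn
        (e.extend_source (I := 𝓡∂ m) ▸ e.continuousOn_extend)
    have hBo : IsOpen (e.source ×ˢ e'.source ∩ B) := by
      have h1 := (hcoord e).isOpen_inter_preimage e.open_source (isOpen_Ioi (a := (0 : ℝ)))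
      have h2 := (hcoord e').isOpen_inter_preimage e'.open_source (isOpen_Ioi (a := (0 : ℝ)))
      convert h1.prod h2 using 1
      ext x
      simp only [B, Set.mem_inter_iff, Set.mem_prod, Set.mem_ofPred_eq, Set.mem_preimage,
        Set.mem_Ioi]
      tauto
    set N := O ∩ (A.dom i ×ˢ A.dom i')
    have hN : IsOpen N := hO.inter hdo
    set N' := N ∩ (e.source ×ˢ e'.source ∩ B)
    have hN' : IsOpen N' := hN.inter hBo
    have hcont : ContinuousOn (frameMatrix (A.frame i) (A.frame i') (R t⁻¹)) N' := by
      intro x hx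
      have hx1 : x.1 ∈ e.source := hx.2.1.1
      have hx2 : x.2 ∈ e'.source := hx.2.1.2
      have hphg := hR.1 e he e' he' i i' (coordsOf e e' t x) ht.le
        (A.inChart_extend hx1 hx.1.2.1) (A.inChart_extend hx2 hx.1.2.2) fun h => ht.ne' h.1
      have h1 : ContinuousAt (A.localKernel R e e' i i') (coordsOf e e' t x) := by
        refine hphg.continuousAt fun j hj => ?_
        rcases j with _ | k | k
        · exact ht
        · rcases eq_or_ne k 0 with rfl | hk
          · exact hx.2.2.1
          · simp [baseFace, hk] at hj
        · rcases eq_or_ne k 0 with rfl | hk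
          · exact hx.2.2.2
          · simp [baseFace, hk] at hj
      have h2 : Tendsto (fun y : M × M => coordsOf e e' t y) (𝓝 x) (𝓝 (coordsOf e e' t x)) :=
        (tendsto_coordsOf hx1 hx2).comp ((tendsto_const_nhds (x := t)).prodMk tendsto_id)
      have h3 : ContinuousAt (fun y => A.localKernel R e e' i i' (coordsOf e e' t y)) x :=
        h1.tendsto.comp h2
      refine (h3.congr ?_).continuousWithinAt
      filter_upwards [(e.open_source.prod e'.open_source).mem_nhds hx.2.1] with y hy
      exact A.localKernel_coordsOf R i i' t hy.1 hy.2
    refine ⟨N, hN.mem_nhds ⟨hxO, hx₀⟩, ?_⟩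
    have hae : (N' : Set (M × M)) =ᵐ[ν.prod ν] N := by
      have h1 : ∀ᵐ x ∂(ν.prod ν), x ∈ O → x ∈ B := (ae_restrict_iff' hO.measurableSet).1 hOae
      refine eventuallyEq_set.2 ?_
      filter_upwards [h1] with x hx
      exact ⟨fun h => h.1, fun h => ⟨h, ⟨(hOs x h.1).1, (hOs x h.1).2⟩, hx h.1⟩⟩
    rw [← Measure.restrict_congr_set hae]
    exact hcont.aestronglyMeasurable hN'.measurableSet
  choose! O hO hOm using hloc
  obtain ⟨c, hcs, hc, hcov⟩ := TopologicalSpace.countable_cover_nhdsWithin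
    (f := O) fun x hx => mem_nhdsWithin_of_mem_nhds (hO x hx)
  have := hc.to_subtype
  have h1 := (aestronglyMeasurable_iUnion_iff (μ := ν.prod ν)
    (f := frameMatrix (A.frame i) (A.frame i') (R t⁻¹)) (s := fun x : c => O x)).2
    fun x => hOm x (hcs x.2)
  refine h1.mono_set ?_
  rwa [← Set.biUnion_eq_iUnion c fun x _ => O x]

end Estimates
end HermitianBundle

theorem hasLeadingOrder_faceOrder {𝓔 : Face → IndexSet} {a : ℝ}
    (hlf : 𝓔 Face.lf = IndexSet.nat) (hrf : 𝓔 Face.rf = IndexSet.nat)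
    (htf : 𝓔 Face.tf = IndexSet.empty) (hff : (𝓔 Face.ff).HasLeadingOrder (a : WithTop ℝ))
    (htd : (𝓔 Face.td).HasLeadingOrder ⊤) (n : ℝ) (f : Face) :
    (𝓔 f).HasLeadingOrder (faceOrder a n f : ℝ) := by
  have hnat : IndexSet.nat.HasLeadingOrder ((0 : ℝ) : WithTop ℝ) := by
    rintro _ ⟨j, rfl⟩
    refine ⟨?_, fun _ => rfl⟩
    exact WithTop.coe_le_coe.2 (by simp)
  cases f with
  | lf => rw [hlf]; exact hnat
  | rf => rw [hrf]; exact hnat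
  | tf => rw [htf]; exact fun g hg => hg.elim
  | td => exact fun g hg => absurd (htd g hg).1 (by simp)
  | ff => exact hff

theorem proposition4p1 {m : ℕ} [NeZero m] {M : Type*} [TopologicalSpace M] [T2Space M]
    [CompactSpace M] [ChartedSpace (EuclideanHalfSpace m) M] [IsManifold (𝓡∂ m) ∞ M]
    [MeasurableSpace M] [BorelSpace M] (ν : Measure M) (hν : IsSmoothDensity m ν)
    {r : ℕ} {E : M → Type*} [∀ p, NormedAddCommGroup (E p)] [∀ p, InnerProductSpace ℂ (E p)]
    (A : HermitianBundle m r E) (ℓ : ℝ) (R : ℝ → ∀ p q, E q →L[ℂ] E p)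
    (hR : R ∈ A.phgKernels ℓ ⊤) :
    ∃ T : ℝ → (A.L2 ν →L[ℂ] A.L2 ν),
      (∀ μ, 0 < μ → HermitianBundle.HasKernel (T μ) (R μ) ∧ IsHilbertSchmidt (T μ)) ∧
      (fun μ => hsNorm (T μ)) =O[atTop] fun μ => μ ^ (-ℓ + (m : ℝ) / 2) := by
  have := (𝓡∂ m).secondCountableTopology
  have := ChartedSpace.secondCountable_of_sigmaCompact (EuclideanHalfSpace m) M
  have := hν.isFiniteMeasure
  obtain ⟨𝓔, hlf, hrf, htf, hff, htd, hlift⟩ := hR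
  rw [WithTop.add_top] at htd
  have hm : (0 : ℝ) < m := by exact_mod_cast NeZero.pos m
  -- the order at td and tf which corresponds to the choice `K = m`; any `K > m / 2` would do
  have h𝓔 := hasLeadingOrder_faceOrder hlf hrf htf hff htd (-(m : ℝ) + ℓ + m)
  have hfin : ∀ μ : ℝ, 0 < μ → ∫⁻ x, ‖R μ x.1 x.2‖ₑ ^ 2 ∂(ν.prod ν) < ⊤ := by
    intro μ hμ
    simpa only [inv_inv] using
      HermitianBundle.lintegral_kernel_lt_top hν hlift h𝓔 (inv_pos.2 hμ)
  have hT : ∀ μ : ℝ, ∃ T : A.L2 ν →L[ℂ] A.L2 ν, 0 < μ → HermitianBundle.HasKernel T (R μ) ∧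
      hsNormSq T ≤ r * ∫⁻ x, ‖R μ x.1 x.2‖ₑ ^ 2 ∂(ν.prod ν) := by
    intro μ
    by_cases hμ : 0 < μ
    · obtain ⟨T, hT⟩ := HermitianBundle.exists_hasKernel_hsNormSq_le (A := A) (ν := ν) (k := R μ)
        (fun i i' => by
          simpa only [inv_inv] using
            HermitianBundle.aestronglyMeasurable_frameMatrix hν hlift (inv_pos.2 hμ) i i')
        (hfin μ hμ)
      exact ⟨T, fun _ => hT⟩
    · exact ⟨0, fun h => absurd h hμ⟩
  choose T hT using hT
  refine ⟨T, fun μ hμ => ⟨(hT μ hμ).1,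
    (hT μ hμ).2.trans_lt (ENNReal.mul_lt_top (by simp) (hfin μ hμ))⟩, ?_⟩
  obtain ⟨C, hC⟩ := HermitianBundle.exists_lintegral_kernel_le hν hlift (K := m) (by linarith) h𝓔
  refine IsBigO.of_bound (Real.sqrt (r * C)) ?_
  filter_upwards [tendsto_inv_atTop_zero.eventually hC, eventually_gt_atTop 0] with μ h1 hμ
  have h2 := h1 (inv_pos.2 hμ)
  rw [inv_inv] at h2
  have h3 : hsNormSq (T μ) ≤
      ENNReal.ofReal (r * C * μ⁻¹ ^ (2 * (-(m : ℝ) + ℓ) + m)) := by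
    refine (hT μ hμ).2.trans ?_
    rw [ENNReal.ofReal_mul (by positivity), ENNReal.ofReal_mul (by positivity),
      ENNReal.ofReal_natCast, ENNReal.ofReal_coe_nnreal, mul_assoc]
    gcongr
  have h4 : μ⁻¹ ^ (2 * (-(m : ℝ) + ℓ) + m) = (μ ^ (-ℓ + (m : ℝ) / 2)) ^ 2 := by
    rw [Real.inv_rpow hμ.le, ← Real.rpow_neg hμ.le, ← Real.rpow_natCast, ← Real.rpow_mul hμ.le]
    congr 1
    push_cast
    ring
  have h5 : 0 ≤ μ ^ (-ℓ + (m : ℝ) / 2) := Real.rpow_nonneg hμ.le _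
  rw [hsNorm, Real.norm_of_nonneg (Real.sqrt_nonneg _), Real.norm_of_nonneg h5,
    ← Real.sqrt_sq h5, ← Real.sqrt_mul (by positivity), ← h4]
  refine Real.sqrt_le_sqrt ?_
  exact ENNReal.toReal_le_of_le_ofReal (by positivity) h3
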